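/- Let $\mathbb F$ be a field of characteristic $0$. Let $p_i=\bar 0$ for $i=1,\dots,4$ and $p_i=\bar 1$ for $i=5,\dots,8$, and let $\mathbb F[\boldsymbol\lambda]=\mathbb F[\lambda_1,\dots,\lambda_4]\otimes\bigwedge(\lambda_5,\dots,\lambda_8)$ and $\mathbb F[\boldsymbol\partial]=\mathbb F[\partial_1,\dots,\partial_4]\otimes\bigwedge(\partial_5,\dots,\partial_8)$. A Lie conformal superalgebra of type $(4,4)$ is a $\mathbb Z/2\mathbb Z$-graded $\mathbb F[\boldsymbol\partial]$-bimodule $R$ with $a\partial_i=(-1)^{p_ip(a)}\partial_i a$ and a $\mathbb Z/2\mathbb Z$-graded bilinear $\boldsymbol\lambda$-bracket $R\times R\to\mathbb F[\boldsymbol\lambda]\otimes R$, $(a,b)\mapsto[a_{\boldsymbol\lambda}b]$, such that $$[(\partial_i a)_{\boldsymbol\lambda} b]=-\lambda_i[a_{\boldsymbol\lambda} b],\quad [a_{\boldsymbol\lambda}(b\partial_i)]=[a_{\boldsymbol\lambda} b](\partial_i+\lambda_i),\quad [b_{\boldsymbol\lambda} a]=-(-1)^{p(a)p(b)}[a_{-\boldsymbol\lambda-\boldsymbol\partial}b],$$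 $$[a_{\boldsymbol\lambda}[b_{\boldsymbol\mu}c]]=[[a_{\boldsymbol\lambda}b]_{\boldsymbol\lambda+\boldsymbol\mu}c]+(-1)^{p(a)p(b)}[b_{\boldsymbol\mu}[a_{\boldsymbol\lambda}c]].$$ Here odd symbols obey the usual sign rule; in particular, on $\mathbb F[\boldsymbol\lambda]\otimes R$, $\partial_i(P\otimes c)=(-1)^{p_ip(P)}P\otimes\partial_ic$ and $(P\otimes c)\lambda_i=(-1)^{p_ip(c)}P\lambda_i\otimes c$. Let $RW(4,4)$ be the free $\mathbb F[\boldsymbol\partial]$-module with generators $a_1,\dots,a_8$, where $a_i$ has parity $p_i$, with the $\boldsymbol\lambda$-bracket given by $[{a_i}_{\boldsymbol\lambda}a_j]=(\partial_i+\lambda_i)a_j+a_i\lambda_j$ and extended by the first two rules above (sesquilinearity). For families $u=(u_1,\dots,u_8)$ and $v=(v_1,\dots,v_8)$ put $$B_{uv}=\sum_{k=1}^4u_kv_{k+4},\qquad C_{uv}=\sum_{k=1}^4(u_kv_{k+4}+u_{k+4}v_k).$$ Put $\nu_1=\partial_6\partial_7\partial_8$, $\nu_2=-\partial_5\partial_7\partial_8$,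 $\nu_3=\partial_5\partial_6\partial_8$, $\nu_4=-\partial_5\partial_6\partial_7$, $\nu_5=\dots=\nu_8=0$, and let $\mu_1,\dots,\mu_8$ be given by the same expressions with $\lambda$ in place of $\partial$. For $i=1,\dots,8$ let $$\alpha_i=\partial_iB_{\partial\partial}C_{\partial a}-2\nu_iC_{\partial a}+\partial_iB_{\nu a}\in RW(4,4),$$ and let $RE(4,4)$ be the $\mathbb F[\boldsymbol\partial]$-submodule of $RW(4,4)$ generated by $\alpha_1,\dots,\alpha_8$. **Theorem.** For all $i,j=1,\dots,8$, $$[{\alpha_i}_{\boldsymbol\lambda}\alpha_j]=(\lambda_i\lambda_jB_{\lambda\lambda}-2\lambda_i\mu_j-2\lambda_j\mu_i)C_{\lambda\alpha}+3\lambda_i\lambda_jB_{\mu\alpha}+(\lambda_iC_{\mu\partial}+\lambda_iB_{\lambda\lambda}C_{\lambda\partial}-2\mu_iC_{\lambda\partial})\alpha_j.$$ In particular, $RW(4,4)$ being a Lie conformal superalgebra of type $(4,4)$, the submodule $RE(4,4)$ is a Lie conformal subalgebra of it: $[a_{\boldsymbol\lambda}b]\in\mathbb F[\boldsymbol\lambda]\otimes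 RE(4,4)$ for all $a,b\in RE(4,4)$, and $RE(4,4)$ with the induced parity and bracket is itself a Lie conformal superalgebra of type $(4,4)$. -/

import Mathlib

open scoped TensorProduct

/-- The sign `(-1) ^ ε` of a parity `ε ∈ ℤ/2ℤ`. -/
def parSign (F : Type*) [Field F] (ε : ZMod 2) : F := (-1) ^ ε.val

lemma parSign_mul_self (F : Type*) [Field F] (ε : ZMod 2) : parSign F ε * parSign F ε = 1 := by
  unfold parSign
  rw [← mul_pow]
  norm_num

/-- The defining relations `x_i x_j = (-1) ^ (p_i p_j) x_j x_i` of super polynomials. -/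
inductive SuperPolyRel (F : Type*) [Field F] {ι : Type*} (p : ι → ZMod 2) :
    FreeAlgebra F ι → FreeAlgebra F ι → Prop
  | comm (i j : ι) : SuperPolyRel F p (FreeAlgebra.ι F i * FreeAlgebra.ι F j)
      (parSign F (p i * p j) • (FreeAlgebra.ι F j * FreeAlgebra.ι F i))

/-- The algebra of super polynomials over `F` in variables indexed by `ι`, where the variable
of index `i` has parity `p i`. If `2` is invertible in `F`, it is the tensor product of the
polynomial algebra in the even variables and of the exterior algebra in the odd variables
(the relation for `i = j` odd says that the square of an odd variable is zero). It serves as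
`F[λ]`, as `F[∂]` and, with a disjoint union of two sets of variables, as `F[λ, μ]`. -/
def SuperPoly (F : Type*) [Field F] {ι : Type*} (p : ι → ZMod 2) : Type _ :=
  RingQuot (SuperPolyRel F p)

namespace SuperPoly

noncomputable section

variable {F : Type*} [Field F] {ι : Type*} {p : ι → ZMod 2}

instance instRing : Ring (SuperPoly F p) := inferInstanceAs (Ring (RingQuot (SuperPolyRel F p)))

instance instAlgebra : Algebra F (SuperPoly F p) :=
  inferInstanceAs (Algebra F (RingQuot (SuperPolyRel F p)))

/-- The variable of index `i`. -/
def X (i : ι) : SuperPoly F p := RingQuot.mkAlgHom F (SuperPolyRel F p) (FreeAlgebra.ι F i)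

lemma smul_superComm {A : Type*} [Ring A] [Algebra F A] (t s : F) (x y : A)
    (h : x * y = s • (y * x)) : (t • x) * (t • y) = s • ((t • y) * (t • x)) := by
  simp only [smul_mul_assoc, mul_smul_comm, h]
  rw [smul_comm t s, smul_comm t s]

lemma X_mul_X (i j : ι) :
    (X i * X j : SuperPoly F p) = parSign F (p i * p j) • (X j * X i) := by
  have h := RingQuot.mkAlgHom_rel F (SuperPolyRel.comm (F := F) (p := p) i j)
  rw [map_smul, map_mul, map_mul] at h
  exact h

/-- The universal property: super commuting elements `f i` of an algebra define an algebra
homomorphism that sends the variable of index `i` to `f i`. -/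
def lift {A : Type*} [Ring A] [Algebra F A] (f : ι → A)
    (hf : ∀ i j, f i * f j = parSign F (p i * p j) • (f j * f i)) : SuperPoly F p →ₐ[F] A :=
  RingQuot.liftAlgHom F ⟨FreeAlgebra.lift F f, by
    rintro _ _ ⟨i, j⟩
    simpa using hf i j⟩

@[simp]
lemma lift_X {A : Type*} [Ring A] [Algebra F A] (f : ι → A)
    (hf : ∀ i j, f i * f j = parSign F (p i * p j) • (f j * f i)) (i : ι) :
    lift f hf (X i : SuperPoly F p) = f i := by
  have h := RingQuot.liftAlgHom_mkAlgHom_apply F (s := SuperPolyRel F p) (FreeAlgebra.lift F f)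
    (by
      rintro _ _ ⟨i, j⟩
      simpa using hf i j) (FreeAlgebra.ι F i)
  rw [FreeAlgebra.lift_ι_apply] at h
  exact h

lemma X_sq_of_odd [CharZero F] {i : ι} (hi : p i = 1) : (X i * X i : SuperPoly F p) = 0 := by
  have h := X_mul_X (F := F) (p := p) i i
  have hs : parSign F (1 * 1) = -1 := by simp [parSign, ZMod.val_one]
  rw [hi, hs, neg_one_smul] at h
  have h2 : (2 : F) • (X i * X i : SuperPoly F p) = 0 := by
    rw [two_smul]
    nth_rewrite 1 [h]
    exact neg_add_cancel _
  exact (smul_eq_zero_iff_right (two_ne_zero : (2 : F) ≠ 0)).mp h2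

/-- The elements of parity `ε`: the span of the monomials `x_{k_1} ⋯ x_{k_t}` with
`p_{k_1} + ⋯ + p_{k_t} = ε`. -/
def homog (F : Type*) [Field F] {ι : Type*} (p : ι → ZMod 2) (ε : ZMod 2) :
    Submodule F (SuperPoly F p) :=
  Submodule.span F {P | ∃ K : List ι, (K.map p).sum = ε ∧ (K.map X).prod = P}

/-- The algebra automorphism `P ↦ (-1) ^ (ε p(P)) P` (for `P` of parity `p(P)`). -/
def twist (ε : ZMod 2) : SuperPoly F p →ₐ[F] SuperPoly F p :=
  lift (fun i => parSign F (ε * p i) • X i) (by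
    intro i j
    simp only [smul_mul_smul_comm]
    rw [X_mul_X i j, smul_comm (parSign F (p i * p j)), mul_comm])

/-- The algebra automorphism `P(x) ↦ P(-x)`. -/
def neg : SuperPoly F p →ₐ[F] SuperPoly F p :=
  lift (fun i => -X i) (by
    intro i j
    rw [neg_mul_neg, neg_mul_neg, X_mul_X])

/-- `P(λ) ↦ P(λ)`, from `F[λ]` to `F[λ, μ]`. -/
def inl : SuperPoly F p →ₐ[F] SuperPoly F (Sum.elim p p) :=
  lift (fun i => X (Sum.inl i)) (fun i j => X_mul_X (Sum.inl i) (Sum.inl j))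

/-- `P(λ) ↦ P(μ)`, from `F[λ]` to `F[λ, μ]`. -/
def inr : SuperPoly F p →ₐ[F] SuperPoly F (Sum.elim p p) :=
  lift (fun i => X (Sum.inr i)) (fun i j => X_mul_X (Sum.inr i) (Sum.inr j))

/-- `P(λ) ↦ P(λ + μ)`, from `F[λ]` to `F[λ, μ]`. -/
def inAdd : SuperPoly F p →ₐ[F] SuperPoly F (Sum.elim p p) :=
  lift (fun i => X (Sum.inl i) + X (Sum.inr i)) (by
    intro i j
    have h1 := X_mul_X (F := F) (p := Sum.elim p p) (Sum.inl i) (Sum.inl j)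
    have h2 := X_mul_X (F := F) (p := Sum.elim p p) (Sum.inl i) (Sum.inr j)
    have h3 := X_mul_X (F := F) (p := Sum.elim p p) (Sum.inr i) (Sum.inl j)
    have h4 := X_mul_X (F := F) (p := Sum.elim p p) (Sum.inr i) (Sum.inr j)
    simp only [Sum.elim_inl, Sum.elim_inr] at h1 h2 h3 h4
    simp only [add_mul, mul_add, h1, h2, h3, h4, smul_add]
    abel)

end

end SuperPoly

namespace LieConformal

open SuperPoly

noncomputable section

section Operators

variable {F : Type*} [Field F] {ι : Type*} {p : ι → ZMod 2}
  {R : Type*} [AddCommGroup R] [Module F R]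

/-- The left action of `λ_i` on `F[λ] ⊗ R`: `P ⊗ c ↦ λ_i P ⊗ c`. -/
def lamOp (i : ι) : Module.End F (SuperPoly F p ⊗[F] R) :=
  LinearMap.rTensor R (LinearMap.mulLeft F (X i : SuperPoly F p))

@[simp]
lemma lamOp_tmul (i : ι) (P : SuperPoly F p) (c : R) : lamOp i (P ⊗ₜ[F] c) = (X i * P) ⊗ₜ c :=
  rfl

lemma lamOp_mul_lamOp (i j : ι) : (lamOp i * lamOp j : Module.End F (SuperPoly F p ⊗[F] R)) =
    parSign F (p i * p j) • (lamOp j * lamOp i) := by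
  refine TensorProduct.ext' fun P c => ?_
  simp only [Module.End.mul_apply, LinearMap.smul_apply, lamOp_tmul, ← mul_assoc]
  rw [X_mul_X i j, smul_mul_assoc, TensorProduct.smul_tmul']

variable [Module (SuperPoly F p) R] [IsScalarTower F (SuperPoly F p) R]

/-- The left action of `∂_i` on `F[λ] ⊗ R`: `P ⊗ c ↦ (-1) ^ (p_i p(P)) P ⊗ ∂_i c`. -/
def parOp (i : ι) : Module.End F (SuperPoly F p ⊗[F] R) :=
  TensorProduct.map (twist (p i)).toLinearMap (Module.toModuleEnd F R (X i : SuperPoly F p))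

@[simp]
lemma parOp_tmul (i : ι) (P : SuperPoly F p) (c : R) :
    parOp i (P ⊗ₜ[F] c) = twist (p i) P ⊗ₜ ((X i : SuperPoly F p) • c) :=
  rfl

lemma parOp_mul_lamOp (i j : ι) : (parOp i * lamOp j : Module.End F (SuperPoly F p ⊗[F] R)) =
    parSign F (p i * p j) • (lamOp j * parOp i) := by
  refine TensorProduct.ext' fun P c => ?_
  simp only [Module.End.mul_apply, LinearMap.smul_apply, lamOp_tmul, parOp_tmul, map_mul]
  simp only [twist, lift_X, smul_mul_assoc, TensorProduct.smul_tmul']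

lemma lamOp_mul_parOp (i j : ι) : (lamOp i * parOp j : Module.End F (SuperPoly F p ⊗[F] R)) =
    parSign F (p i * p j) • (parOp j * lamOp i) := by
  rw [parOp_mul_lamOp, smul_smul, mul_comm (p j), parSign_mul_self, one_smul]

lemma twist_twist_comm (ε δ : ZMod 2) (P : SuperPoly F p) :
    twist ε (twist δ P) = twist δ (twist ε P) := by
  have h : ((twist ε).comp (twist δ) : SuperPoly F p →ₐ[F] SuperPoly F p) =
      (twist δ).comp (twist ε) := by
    refine RingQuot.ringQuot_ext' _ _ _ (FreeAlgebra.hom_ext (funext fun i => ?_))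
    change twist ε (twist δ (X i)) = twist δ (twist ε (X i))
    simp only [twist, lift_X, map_smul]
    rw [smul_comm]
  exact DFunLike.congr_fun h P

lemma parOp_mul_parOp (i j : ι) : (parOp i * parOp j : Module.End F (SuperPoly F p ⊗[F] R)) =
    parSign F (p i * p j) • (parOp j * parOp i) := by
  refine TensorProduct.ext' fun P c => ?_
  simp only [Module.End.mul_apply, LinearMap.smul_apply, parOp_tmul]
  rw [smul_smul, smul_smul, X_mul_X i j, twist_twist_comm, smul_assoc, TensorProduct.tmul_smul]

/-- For a scalar `t`, the substitution of the operators `t (λ_i + ∂_i)` on `F[λ] ⊗ R` for the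
variables of a super polynomial. -/
def shift (t : F) : SuperPoly F p →ₐ[F] Module.End F (SuperPoly F p ⊗[F] R) :=
  lift (fun i => t • (lamOp i + parOp i)) (by
    intro i j
    have h : ((lamOp i + parOp i) * (lamOp j + parOp j) :
        Module.End F (SuperPoly F p ⊗[F] R)) =
        parSign F (p i * p j) • ((lamOp j + parOp j) * (lamOp i + parOp i)) := by
      rw [add_mul, mul_add, mul_add, add_mul, mul_add, mul_add, lamOp_mul_lamOp i j,
        lamOp_mul_parOp i j, parOp_mul_lamOp i j, parOp_mul_parOp i j]
      simp only [smul_add]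
      abel
    exact smul_superComm t _ _ _ h)

/-- The substitution of `-λ - ∂` for `λ`: the map `P(λ) ⊗ c ↦ P(-λ-∂) c` on `F[λ] ⊗ R`, which
sends `[a_λ b]` to `[a_{-λ-∂} b]`. -/
def substNeg : SuperPoly F p ⊗[F] R →ₗ[F] SuperPoly F p ⊗[F] R :=
  TensorProduct.lift
    ((LinearMap.lcomp F (SuperPoly F p ⊗[F] R)
      (TensorProduct.mk F (SuperPoly F p) R 1)).comp (shift (-1 : F)).toLinearMap)

/-- The elements of parity `ε` of `F[λ] ⊗ R`, for a grading `gr` of `R`. -/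
def tensorGr (gr : ZMod 2 → Submodule F R) (ε : ZMod 2) : Submodule F (SuperPoly F p ⊗[F] R) :=
  Submodule.span F {t | ∃ γ δ : ZMod 2, γ + δ = ε ∧
    ∃ P ∈ homog F p γ, ∃ c ∈ gr δ, P ⊗ₜ[F] c = t}

/-- For `T : R → F[λ] ⊗ R` and algebra homomorphisms `f, g : F[λ] → F[λ, μ]`, the map
`F[λ] ⊗ R → F[λ, μ] ⊗ R` that sends `P ⊗ c` to `g(P) · (f ⊗ id)(T c)`. -/
def extend (f g : SuperPoly F p →ₐ[F] SuperPoly F (Sum.elim p p))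
    (T : R →ₗ[F] SuperPoly F p ⊗[F] R) :
    SuperPoly F p ⊗[F] R →ₗ[F] SuperPoly F (Sum.elim p p) ⊗[F] R :=
  TensorProduct.lift (LinearMap.mk₂ F
    (fun (P : SuperPoly F p) (c : R) => g P • LinearMap.rTensor R f.toLinearMap (T c))
    (by intros; simp [add_smul]) (by intros; simp) (by intros; simp)
    (by intro t P c; rw [map_smul, map_smul, smul_comm]))

end Operators

/-- Let `R` be an `F[∂]`-module with a decomposition `gr` into an even and an odd part and a
bilinear operation `br a b = [a_λ b]` with values in `F[λ] ⊗ R`, where the indices of the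
variables and their parities are given by `ι` and `p`. This is the statement that `R` is a Lie
conformal superalgebra. The right action of `∂_i` on `R` is `a ∂_i = (-1) ^ (p_i p(a)) ∂_i a`, so
that `[a_λ (b ∂_i)] = [a_λ b] (∂_i + λ_i)` is the rule `sesq_right`, written with left actions. -/
structure IsLieConformalSuperalgebra {F : Type*} [Field F] {ι : Type*} {p : ι → ZMod 2}
    {R : Type*} [AddCommGroup R] [Module F R] [Module (SuperPoly F p) R]
    [IsScalarTower F (SuperPoly F p) R]
    (gr : ZMod 2 → Submodule F R) (br : R →ₗ[F] R →ₗ[F] SuperPoly F p ⊗[F] R) : Prop where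
  isCompl : IsCompl (gr 0) (gr 1)
  smul_mem : ∀ (i : ι) (ε : ZMod 2) (a : R), a ∈ gr ε → (X i : SuperPoly F p) • a ∈ gr (p i + ε)
  bracket_mem : ∀ (ε δ : ZMod 2) (a b : R), a ∈ gr ε → b ∈ gr δ → br a b ∈ tensorGr gr (ε + δ)
  /-- `[(∂_i a)_λ b] = -λ_i [a_λ b]` -/
  sesq_left : ∀ (i : ι) (a b : R), br ((X i : SuperPoly F p) • a) b = -lamOp i (br a b)
  /-- `[a_λ (∂_i b)] = (-1) ^ (p_i p(a)) (∂_i + λ_i) [a_λ b]` -/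
  sesq_right : ∀ (i : ι) (ε : ZMod 2) (a b : R), a ∈ gr ε →
    br a ((X i : SuperPoly F p) • b) =
      parSign F (p i * ε) • (parOp i (br a b) + lamOp i (br a b))
  /-- `[b_λ a] = -(-1) ^ (p(a) p(b)) [a_{-λ-∂} b]` -/
  skew : ∀ (ε δ : ZMod 2) (a b : R), a ∈ gr ε → b ∈ gr δ →
    br b a = -(parSign F (ε * δ) • substNeg (br a b))
  /-- `[a_λ [b_μ c]] = [[a_λ b]_{λ+μ} c] + (-1) ^ (p(a) p(b)) [b_μ [a_λ c]]`, where
  `[a_λ P(μ) d] = (-1) ^ (p(a) p(P)) P(μ) [a_λ d]`. -/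
  jacobi : ∀ (ε δ : ZMod 2) (a b c : R), a ∈ gr ε → b ∈ gr δ →
    extend inl (inr.comp (twist ε)) (br a) (br b c) =
      extend inAdd inl (br.flip c) (br a b) +
        parSign F (ε * δ) • extend inr (inl.comp (twist δ)) (br b) (br a c)

/-- The `F[∂]`-submodule `S` of `R` is a Lie conformal subalgebra for the `λ`-bracket `br`:
`[a_λ b] ∈ F[λ] ⊗ S` for all `a, b ∈ S`, and with the bracket and the parity that it has in `R`
(in particular it is the sum of its even and odd parts) it is a Lie conformal superalgebra. -/
def IsLieConformalSubalgebra {F : Type*} [Field F] {ι : Type*} {p : ι → ZMod 2}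
    {R : Type*} [AddCommGroup R] [Module F R] [Module (SuperPoly F p) R]
    [IsScalarTower F (SuperPoly F p) R]
    (gr : ZMod 2 → Submodule F R) (br : R →ₗ[F] R →ₗ[F] SuperPoly F p ⊗[F] R)
    (S : Submodule (SuperPoly F p) R) : Prop :=
  ∃ brS : S →ₗ[F] S →ₗ[F] SuperPoly F p ⊗[F] S,
    (∀ a b : S, LinearMap.lTensor (SuperPoly F p) (S.subtype.restrictScalars F) (brS a b) =
      br (a : R) (b : R)) ∧
    IsLieConformalSuperalgebra (fun ε => (gr ε).comap (S.subtype.restrictScalars F)) brS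

/-- The parities in type `(r, s)`: the `r` indices `inl k` are even, the `s` indices `inr k` are
odd; so `inl k` and `inr k` (with `k` counted from `0`) are the indices `k + 1` and
`r + k + 1`. -/
def typeParity (r s : ℕ) : Fin r ⊕ Fin s → ZMod 2 := Sum.elim (fun _ => 0) (fun _ => 1)

section RW

variable (F : Type*) [Field F] (r s : ℕ)

/-- `F[∂]` (and `F[λ]`) in type `(r, s)`. -/
abbrev Poly : Type _ := SuperPoly F (typeParity r s)

/-- The free `F[∂]`-module `RW(r, s)`. -/
abbrev RW : Type _ := Fin r ⊕ Fin s → Poly F r s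

/-- The free generators `a_i` of `RW(r, s)`. -/
def rwGen (i : Fin r ⊕ Fin s) : RW F r s := Pi.single i 1

/-- The parity of `RW(r, s)`, where `a_i` has parity `p_i`. -/
def rwGr (ε : ZMod 2) : Submodule F (RW F r s) :=
  Submodule.pi Set.univ (fun i => homog F (typeParity r s) (ε + typeParity r s i))

/-- `[a_i_λ a_j] = (∂_i + λ_i) a_j + a_i λ_j`, where `a_i λ_j = (-1) ^ (p_i p_j) λ_j a_i`. -/
def rwGenBr (i j : Fin r ⊕ Fin s) : Poly F r s ⊗[F] RW F r s :=
  1 ⊗ₜ ((X i : Poly F r s) • rwGen F r s j) + X i ⊗ₜ rwGen F r s j +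
    parSign F (typeParity r s i * typeParity r s j) • (X j ⊗ₜ rwGen F r s i)

/-- The extension of the bracket of the generators by sesquilinearity:
`[(P(∂) a_i)_λ (Q(∂) a_j)] = (-1) ^ (p(Q) p_i) P(-λ) Q(∂ + λ) [a_i_λ a_j]`. -/
def rwBr : RW F r s →ₗ[F] RW F r s →ₗ[F] Poly F r s ⊗[F] RW F r s :=
  LinearMap.mk₂ F
    (fun x y => ∑ i, ∑ j, neg (x i) •
      shift (1 : F) (twist (typeParity r s i) (y j)) (rwGenBr F r s i j))
    (by intros; simp [add_smul, Finset.sum_add_distrib])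
    (by intros; simp [Finset.smul_sum])
    (by intros; simp [Finset.sum_add_distrib])
    (by
      intro t x y
      simp only [Pi.smul_apply, map_smul, LinearMap.smul_apply, Finset.smul_sum]
      exact Finset.sum_congr rfl fun i _ => Finset.sum_congr rfl fun j _ => smul_comm _ _ _)

lemma rwBr_gen (i j : Fin r ⊕ Fin s) :
    rwBr F r s (rwGen F r s i) (rwGen F r s j) = rwGenBr F r s i j := by
  rw [rwBr, LinearMap.mk₂_apply, Finset.sum_eq_single i, Finset.sum_eq_single j]
  · simp [rwGen]
  · intro k _ hk
    simp [rwGen, Pi.single_eq_of_ne hk]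
  · simp
  · intro k _ hk
    simp [rwGen, Pi.single_eq_of_ne hk]
  · simp

end RW

section RE

variable (F : Type*) [Field F]

/-- `B_{uv} = u_1 v_5 + u_2 v_6 + u_3 v_7 + u_4 v_8`, for a given product. -/
def pairB {U V W : Type*} [AddCommMonoid W] (m : U → V → W) (u : Fin 4 ⊕ Fin 4 → U)
    (v : Fin 4 ⊕ Fin 4 → V) : W :=
  ∑ k : Fin 4, m (u (Sum.inl k)) (v (Sum.inr k))

/-- `C_{uv} = ∑_{k = 1, …, 4} (u_k v_{k + 4} + u_{k + 4} v_k)`, for a given product. -/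
def pairC {U V W : Type*} [AddCommMonoid W] (m : U → V → W) (u : Fin 4 ⊕ Fin 4 → U)
    (v : Fin 4 ⊕ Fin 4 → V) : W :=
  ∑ k : Fin 4, (m (u (Sum.inl k)) (v (Sum.inr k)) + m (u (Sum.inr k)) (v (Sum.inl k)))

/-- With `x` the variables, `x_6 x_7 x_8`, `-x_5 x_7 x_8`, `x_5 x_6 x_8`, `-x_5 x_6 x_7` for the
indices `1, …, 4`, and zero for `5, …, 8`: these are the `ν_i` in `F[∂]` and the `μ_i` in
`F[λ]`. -/
def cubic : Fin 4 ⊕ Fin 4 → Poly F 4 4 :=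
  Sum.elim
    ![X (Sum.inr 1) * X (Sum.inr 2) * X (Sum.inr 3),
      -(X (Sum.inr 0) * X (Sum.inr 2) * X (Sum.inr 3)),
      X (Sum.inr 0) * X (Sum.inr 1) * X (Sum.inr 3),
      -(X (Sum.inr 0) * X (Sum.inr 1) * X (Sum.inr 2))]
    (fun _ => 0)

/-- `α_i = ∂_i B_{∂∂} C_{∂a} - 2 ν_i C_{∂a} + ∂_i B_{νa}`. -/
def alpha (i : Fin 4 ⊕ Fin 4) : RW F 4 4 :=
  (X i * pairB (· * ·) X X : Poly F 4 4) • pairC (· • ·) (X : _ → Poly F 4 4) (rwGen F 4 4)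
    - (2 * cubic F i) • pairC (· • ·) (X : _ → Poly F 4 4) (rwGen F 4 4)
    + (X i : Poly F 4 4) • pairB (· • ·) (cubic F) (rwGen F 4 4)

/-- `RE(4, 4)`, the `F[∂]`-submodule generated by the `α_i`. -/
def RE : Submodule (Poly F 4 4) (RW F 4 4) := Submodule.span (Poly F 4 4) (Set.range (alpha F))

/-- The action of `F[λ] ⊗ F[∂]` on an element `x` of `RW(4, 4)`: `P ⊗ Q ↦ P ⊗ Q x`. -/
def actOn (x : RW F 4 4) : Poly F 4 4 ⊗[F] Poly F 4 4 →ₗ[F] Poly F 4 4 ⊗[F] RW F 4 4 :=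
  LinearMap.lTensor (Poly F 4 4)
    ((LinearMap.toSpanSingleton (Poly F 4 4) (RW F 4 4) x).restrictScalars F)

end RE

end

end LieConformal

/-! Write α_i = Σ_k A_ik(∂) a_k, and let λ_i and ∂_i act as operators on F[λ] ⊗ RW(4, 4); they form
two super commuting families. Put w = λ + ∂. Each A_ik has degree four, so A_ik(-λ) = A_ik(λ), and
sesquilinearity gives as coefficient of 1 ⊗ a_k in [α_i_λ α_j] the operator Σ_n A_in(λ) w_n A_jk(w)
± A_ik(λ) Σ_n A_jn(w) λ_n. The right side of the formula expands in the same way. The bracket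
formula is therefore a family of identities, indexed by (i, j, k), in 16 super commuting variables.

Two observations keep the verification small. First, A_ik is φ_i x_{k'} plus x_i times a cubic dual
term, where φ_i = x_i B_{xx} - 2 ν_i and k' is the index dual to k. Hence the difference of the two
sides is φ_i(λ) Y + λ_i Z, where Y and Z depend only on (j, k). Second, ν_k is the derivative of x_5
x_6 x_7 x_8 with respect to x_{k+4}, so an even permutation applied to the even and the odd indices
at once preserves all expressions. The alternating group on four letters is doubly transitive, which
leaves eight pairs (j, k). These are evaluated by the kernel in the normal form `SuperTree`. The
result passes to arbitrary rings by `bracketDiff_eq_zero` and `alpha_bracket_coeff`, and to the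
bracket by `rwBr_alpha`.

That RW(r, s) satisfies the axioms follows from `IsLieConformalSuperalgebra.of_generators`:
sesquilinearity moves every ∂_i out of every argument, so grading, skew-symmetry and the Jacobi
identity need checking only on the a_i, where Jacobi is a comparison of 19 kinds of terms with signs
(`rwGen_jacobi`).

By the formula, the brackets of the α_i lie in the image of F[λ] ⊗ RE(4, 4), and sesquilinearity
extends this to all of RE(4, 4). Over a field, tensoring preserves injections. The bracket therefore
restricts uniquely, and all identities are inherited
(`IsLieConformalSuperalgebra.isSubalgebra_span`). -/

set_option linter.unusedSectionVars false

/-! ### Verified arithmetic of super polynomials in Horner form -/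

/-- Super polynomials with integer coefficients in variables `x_0, x_1, …`, the first eight of
which are odd, in a form suited to evaluation by the kernel: `node v p q` stands for
`p + x_v q`. -/
inductive SuperTree
  | const (n : ℤ)
  | node (v : ℕ) (p q : SuperTree)

namespace SuperTree

noncomputable section

/-- `force n k = k n`, where the kernel evaluates `n` before it is handed to `k`. -/
def forceNat {B : Type} (n : ℕ) (k : ℕ → B) : B := Nat.rec (k 0) (fun m _ => k (Nat.succ m)) n

/-- `forceInt n k = k n`, where the kernel evaluates `n` before it is handed to `k`. -/
def forceInt {B : Type} (n : ℤ) (k : ℤ → B) : B :=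
  Int.rec (fun m => forceNat m fun m => k (Int.ofNat m))
    (fun m => forceNat m fun m => k (Int.negSucc m)) n

/-- `force t k = k t`, where the kernel evaluates `t` before it is handed to `k`. -/
def force {B : Type} (t : SuperTree) (k : SuperTree → B) : B :=
  SuperTree.rec (fun n => k (const n)) (fun v p q _ _ => k (node v p q)) t

lemma forceNat_eq {B : Type} (n : ℕ) (k : ℕ → B) : forceNat n k = k n := by
  cases n <;> rfl

lemma forceInt_eq {B : Type} (n : ℤ) (k : ℤ → B) : forceInt n k = k n := by
  cases n with
  | ofNat m => exact forceNat_eq m fun m => k (Int.ofNat m)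
  | negSucc m => exact forceNat_eq m fun m => k (Int.negSucc m)

@[simp]
lemma force_eq {B : Type} (t : SuperTree) (k : SuperTree → B) : force t k = k t := by
  cases t <;> rfl

/-- `p + x_v q`, where `q = 0` is detected. -/
def mk (v : ℕ) (p q : SuperTree) : SuperTree :=
  SuperTree.rec
    (fun n => Int.rec (fun m => Nat.rec p (fun m' _ => node v p (const (Int.ofNat (Nat.succ m')))) m)
      (fun m => node v p (const (Int.negSucc m))) n)
    (fun w p' q' _ _ => node v p (node w p' q')) q

/-- Application of the functions `f` and `g` to the constituents of a node. -/
def nodeForce (v : ℕ) (p q : SuperTree) : SuperTree :=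
  force p fun p => force q fun q => node v p q

/-- Application of a function to all coefficients. -/
def mapCoeff (f : ℤ → ℤ) (t : SuperTree) : SuperTree :=
  SuperTree.rec (fun n => forceInt (f n) const) (fun v _ _ p q => nodeForce v p q) t

/-- Addition of a constant. -/
def addConst (m : ℤ) (t : SuperTree) : SuperTree :=
  SuperTree.rec (fun n => forceInt (Int.add n m) const)
    (fun v _ q h _ => force h fun h => node v h q) t

/-- Addition of `p + x_v q`, where `ap` and `aq` are the additions of `p` and `q`. -/
def addNode (v : ℕ) (q : SuperTree) (ap aq : SuperTree → SuperTree) (t : SuperTree) : SuperTree :=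
  SuperTree.rec (fun n => force (ap (const n)) fun r => node v r q)
    (fun w p' q' h _ =>
      bif Nat.blt v w then force (ap (node w p' q')) fun r => node v r q
      else bif Nat.beq v w then force (aq q') fun b => force (ap p') fun a => mk v a b
      else force h fun r => node w r q') t

/-- Addition. -/
def add (t : SuperTree) : SuperTree → SuperTree :=
  SuperTree.rec (fun n => addConst n) (fun v _ q hp hq => addNode v q hp hq) t

/-- Change of sign. -/
def neg (t : SuperTree) : SuperTree := mapCoeff Int.neg t

/-- Multiplication by `x_v` from the left, and by `-1` if `s` is true. -/
def mulVar (v : ℕ) (t : SuperTree) : Bool → SuperTree :=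
  SuperTree.rec
    (fun n s => bif s then forceInt (Int.neg n) fun n => mk v (const 0) (const n)
      else mk v (const 0) (const n))
    (fun w p q hp hq s =>
      bif Nat.blt v w then force (bif s then neg (node w p q) else node w p q) (node v (const 0))
      else bif Nat.beq v w then
        bif Nat.blt v 8 then bif s then mk v (const 0) (neg p) else mk v (const 0) p
        else force (bif s then neg (node w p q) else node w p q) (node v (const 0))
      else nodeForce w (hp s) (hq (bif Nat.blt v 8 && Nat.blt w 8 then not s else s))) t

/-- Multiplication. -/
def mul (t : SuperTree) : SuperTree → SuperTree :=
  SuperTree.rec (fun n R => bif Int.beq' n 1 then R else mapCoeff (Int.mul n) R)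
    (fun v _ _ hp hq R => force R fun R => force (hq R) fun b => force (mulVar v b false) fun b =>
      force (hp R) fun a => add a b) t

/-- The test whether all coefficients are zero. -/
def isZero (t : SuperTree) : Bool :=
  SuperTree.rec (fun n => Int.beq' n 0) (fun _ _ _ p q => p && q) t

/-- The variable `x_v`. -/
def var (v : ℕ) : SuperTree := node v (const 0) (const 1)

instance : Zero SuperTree := ⟨const 0⟩
instance : Add SuperTree := ⟨fun s t => force s fun s => force t fun t => add s t⟩
instance : Neg SuperTree := ⟨neg⟩
instance : Mul SuperTree := ⟨mul⟩

section Eval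

variable {A : Type*} [Ring A] (x : ℕ → A)

/-- The value for given values of the variables. -/
def eval (t : SuperTree) : A :=
  SuperTree.rec (fun n => (n : A)) (fun v _ _ p q => p + x v * q) t

@[simp] lemma eval_const (n : ℤ) : eval x (const n) = (n : A) := rfl

@[simp] lemma eval_node (v : ℕ) (p q : SuperTree) :
    eval x (node v p q) = eval x p + x v * eval x q := rfl

@[simp] lemma eval_var (v : ℕ) : eval x (var v) = x v := by simp [var]

@[simp] lemma eval_nodeForce (v : ℕ) (p q : SuperTree) :
    eval x (nodeForce v p q) = eval x p + x v * eval x q := by simp [nodeForce]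

@[simp]
lemma eval_mk (v : ℕ) (p q : SuperTree) : eval x (mk v p q) = eval x p + x v * eval x q := by
  cases q with
  | const n =>
    rcases n with (_ | n) | n
    · change eval x p = eval x p + x v * ((0 : ℤ) : A)
      simp
    · rfl
    · rfl
  | node w p q => rfl

lemma eval_mapCoeff_mul (m : ℤ) (f : ℤ → ℤ) (hf : ∀ n, f n = m * n) (t : SuperTree) :
    eval x (mapCoeff f t) = m * eval x t := by
  induction t with
  | const n =>
    change eval x (forceInt (f n) const) = _
    rw [forceInt_eq, hf]
    simp
  | node v p q hp hq =>
    change eval x (nodeForce v (mapCoeff f p) (mapCoeff f q)) = _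
    rw [eval_nodeForce, hp, hq, eval_node, mul_add, ← mul_assoc, ← mul_assoc,
      (Int.cast_commute m (x v)).eq]

lemma eval_neg (t : SuperTree) : eval x (neg t) = -eval x t := by
  rw [neg, eval_mapCoeff_mul x (-1) _ (fun n => by rw [neg_one_mul]; rfl)]
  simp

lemma eval_addConst (m : ℤ) (t : SuperTree) : eval x (addConst m t) = m + eval x t := by
  induction t with
  | const n =>
    change eval x (forceInt (n + m) const) = _
    rw [forceInt_eq]
    simp [add_comm]
  | node v p q hp hq =>
    change eval x (force (addConst m p) fun h => node v h q) = _
    rw [force_eq, eval_node, hp, eval_node, add_assoc]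

/-- The hypotheses on `ap` and `aq` are the induction hypotheses of the outer recursion in `add`,
which runs over the other summand. The variable with the smaller number goes to the outside. -/
lemma eval_addNode (v : ℕ) (p q : SuperTree) (ap aq : SuperTree → SuperTree)
    (hp : ∀ t, eval x (ap t) = eval x p + eval x t)
    (hq : ∀ t, eval x (aq t) = eval x q + eval x t) (t : SuperTree) :
    eval x (addNode v q ap aq t) = eval x (node v p q) + eval x t := by
  induction t with
  | const n =>
    change eval x (force (ap (const n)) fun r => node v r q) = _
    rw [force_eq, eval_node, hp, eval_node]
    abel
  | node w p' q' hp' hq' =>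
    change eval x (bif Nat.blt v w then force (ap (node w p' q')) fun r => node v r q
      else bif Nat.beq v w then force (aq q') fun b => force (ap p') fun a => mk v a b
      else force (addNode v q ap aq p') fun r => node w r q') = _
    simp only [force_eq]
    cases Nat.blt v w
    · cases h : Nat.beq v w
      · simp only [cond_false, eval_node, hp']
        abel
      · obtain rfl := Nat.eq_of_beq_eq_true h
        simp only [cond_false, cond_true, eval_node, eval_mk, hp, hq, mul_add]
        abel
    · simp only [cond_true, eval_node, hp]
      abel

lemma eval_add (s t : SuperTree) : eval x (add s t) = eval x s + eval x t := by
  induction s generalizing t with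
  | const n => exact eval_addConst x n t
  | node v p q hp hq => exact eval_addNode x v p q _ _ hp hq t

/-- Only this direction is ever used. Whether trees are really ordered normal forms therefore
affects the success of a test, but not its soundness. -/
lemma eval_eq_zero {t : SuperTree} (h : isZero t = true) : eval x t = 0 := by
  induction t with
  | const n =>
    have h' : Int.beq' n 0 = true := h
    rw [Int.beq'_eq] at h'
    obtain rfl := h'
    simp
  | node v p q hp hq =>
    have h' : (isZero p && isZero q) = true := h
    rw [Bool.and_eq_true] at h'
    rw [eval_node, hp h'.1, hq h'.2, mul_zero, add_zero]

/-- The values `x_v` of the variables satisfy the relations of super polynomials in which the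
first eight variables are odd. -/
structure IsSuper : Prop where
  comm : ∀ v w, x v * x w = if v < 8 ∧ w < 8 then -(x w * x v) else x w * x v
  sq : ∀ v < 8, x v * x v = 0

variable {x}

/-- The factor x_v travels inwards past every x_w with w < v, and the flag `s` accumulates the signs
from pairs of odd variables. On meeting itself, an odd x_v annihilates the part that already
contains it. -/
lemma eval_mulVar (hx : IsSuper x) (v : ℕ) (t : SuperTree) (s : Bool) :
    eval x (mulVar v t s) = bif s then -(x v * eval x t) else x v * eval x t := by
  induction t generalizing s with
  | const n =>
    change eval x (bif s then forceInt (Int.neg n) fun n => mk v (const 0) (const n)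
      else mk v (const 0) (const n)) = _
    have hn : Int.neg n = -n := rfl
    rw [forceInt_eq, hn]
    cases s <;> simp
  | node w p q hp hq =>
    change eval x (bif Nat.blt v w then
        force (bif s then neg (node w p q) else node w p q) (node v (const 0))
      else bif Nat.beq v w then
        bif Nat.blt v 8 then bif s then mk v (const 0) (neg p) else mk v (const 0) p
        else force (bif s then neg (node w p q) else node w p q) (node v (const 0))
      else nodeForce w (mulVar v p s)
        (mulVar v q (bif Nat.blt v 8 && Nat.blt w 8 then not s else s))) = _
    -- This covers the two cases in which x_v is simply put in front of the whole tree: v < w, and v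
    -- = w even.
    have key : eval x (force (bif s then neg (node w p q) else node w p q) (node v (const 0))) =
        bif s then -(x v * eval x (node w p q)) else x v * eval x (node w p q) := by
      cases s
      · simp
      · simp only [cond_true, force_eq, eval_node, eval_neg, eval_const, Int.cast_zero, zero_add, mul_neg]
    cases Nat.blt v w
    · cases h : Nat.beq v w
      · have hc := hx.comm v w
        simp only [cond_false, eval_nodeForce, hp, hq, eval_node, mul_add]
        rw [← mul_assoc (x v) (x w), hc]
        by_cases h1 : v < 8
        · by_cases h2 : w < 8
          · have e1 : Nat.blt v 8 = true := Nat.ble_eq_true_of_le h1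
            have e2 : Nat.blt w 8 = true := Nat.ble_eq_true_of_le h2
            cases s <;> simp [h1, h2, e1, e2, mul_assoc, add_comm]
          · have e2 : Nat.blt w 8 = false := by
              rw [← Bool.not_eq_true]
              exact fun e => h2 (Nat.le_of_ble_eq_true e)
            cases s <;> simp [h2, e2, mul_assoc, add_comm]
        · have e1 : Nat.blt v 8 = false := by
            rw [← Bool.not_eq_true]
            exact fun e => h1 (Nat.le_of_ble_eq_true e)
          cases s <;> simp [h1, e1, mul_assoc, add_comm]
      · obtain rfl := Nat.eq_of_beq_eq_true h
        cases h8 : Nat.blt v 8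
        · simpa using key
        · have hs := hx.sq v (Nat.le_of_ble_eq_true h8)
          cases s <;> simp [mul_add, ← mul_assoc, hs, eval_neg]
    · simpa using key

lemma eval_mul (hx : IsSuper x) (s t : SuperTree) : eval x (mul s t) = eval x s * eval x t := by
  induction s generalizing t with
  | const n =>
    change eval x (bif Int.beq' n 1 then t else mapCoeff (Int.mul n) t) = _
    cases h : Int.beq' n 1
    · exact eval_mapCoeff_mul x n _ (fun _ => rfl) t
    · rw [Int.beq'_eq] at h
      obtain rfl := h
      simp
  | node v p q hp hq =>
    change eval x (force t fun t => force (mul q t) fun b => force (mulVar v b false) fun b =>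
      force (mul p t) fun a => add a b) = _
    simp only [force_eq, eval_add, eval_mulVar hx, hp, hq, eval_node, add_mul, mul_assoc, cond_false]

@[simp] lemma eval_zero' : eval x 0 = 0 := by
  change ((0 : ℤ) : A) = 0
  simp

@[simp] lemma eval_neg' (t : SuperTree) : eval x (-t) = -eval x t := eval_neg x t

@[simp] lemma eval_add' (s t : SuperTree) : eval x (s + t) = eval x s + eval x t := by
  change eval x (force s fun s => force t fun t => add s t) = _
  simp only [force_eq, eval_add]

end Eval

end

end SuperTree

/-! ### The bracket formula as expressions over an arbitrary ring -/

section Expressions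

variable {A : Type*} [Zero A] [Add A] [Neg A] [Mul A]

/-- `B_{uv} r`. -/
def mulB (u v : Fin 4 ⊕ Fin 4 → A) (r : A) : A :=
  u (.inl 0) * (v (.inr 0) * r) + u (.inl 1) * (v (.inr 1) * r) +
    (u (.inl 2) * (v (.inr 2) * r) + u (.inl 3) * (v (.inr 3) * r))

/-- `C_{uv} r`. -/
def mulC (u v : Fin 4 ⊕ Fin 4 → A) (r : A) : A :=
  mulB u v r + (u (.inr 0) * (v (.inl 0) * r) + u (.inr 1) * (v (.inl 1) * r) +
    (u (.inr 2) * (v (.inl 2) * r) + u (.inr 3) * (v (.inl 3) * r)))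

/-- The cubic expressions `u_6 u_7 u_8`, … -/
def cubicOf (u : Fin 4 ⊕ Fin 4 → A) : Fin 4 ⊕ Fin 4 → A
  | .inl 0 => u (.inr 1) * (u (.inr 2) * u (.inr 3))
  | .inl 1 => -(u (.inr 0) * (u (.inr 2) * u (.inr 3)))
  | .inl 2 => u (.inr 0) * (u (.inr 1) * u (.inr 3))
  | .inl 3 => -(u (.inr 0) * (u (.inr 1) * u (.inr 2)))
  | .inr _ => 0

/-- The coefficient of `a_k` in `B_{νa}`. -/
def cubicDual (u : Fin 4 ⊕ Fin 4 → A) : Fin 4 ⊕ Fin 4 → A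
  | .inl _ => 0
  | .inr k => cubicOf u (.inl k)

/-- `(u_i B_{uu} - 2 ν_i) r`. -/
def mulPhi (u : Fin 4 ⊕ Fin 4 → A) (i : Fin 4 ⊕ Fin 4) (r : A) : A :=
  u i * mulB u u r + -(cubicOf u i * (r + r))

/-- The coefficient of `a_k` in `α_i`, for the variables `u`. -/
def alphaCoeff (u : Fin 4 ⊕ Fin 4 → A) (i k : Fin 4 ⊕ Fin 4) : A :=
  mulPhi u i (u k.swap) + u i * cubicDual u k

/-- `-a` or `a`, depending on whether `s` is true. -/
def signIf (s : Bool) (a : A) : A := bif s then -a else a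

/-- The sum of the values of a function on `Fin 4 ⊕ Fin 4`. -/
def sumAll (f : Fin 4 ⊕ Fin 4 → A) : A :=
  f (.inl 0) + f (.inl 1) + (f (.inl 2) + f (.inl 3)) +
    (f (.inr 0) + f (.inr 1) + (f (.inr 2) + f (.inr 3)))

/-- `∑ k, alphaCoeff u i k * (v k * r)`. -/
def mulAlpha (u v : Fin 4 ⊕ Fin 4 → A) (i : Fin 4 ⊕ Fin 4) (r : A) : A :=
  mulPhi u i (mulC u v r) + u i * mulB (cubicOf u) v r

/-- The sum over `n` of `v_n` times the coefficient of `a_k` in the `α` of index dual to `n`. -/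
def alphaSum (v d : Fin 4 ⊕ Fin 4 → A) (k : Fin 4 ⊕ Fin 4) : A :=
  sumAll fun n => v n * alphaCoeff d n.swap k

/-- In the coefficient of `a_k` in the difference of the two sides of the formula for
`[α_i_λ α_j]`, the cofactor of `λ_i B_{λλ} - 2 μ_i`. Here `w = λ + ∂` and `h` is the value of `α_j`, as an
expression in `w`, when `a_k` is replaced by `λ_k`. -/
def bracketY (l d w : Fin 4 ⊕ Fin 4 → A) (h : A) (j k : Fin 4 ⊕ Fin 4) : A :=
  mulC l w (alphaCoeff w j k) + signIf (j.isRight && k.isRight) (l k.swap * h) +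
    -(signIf j.isRight (l j * alphaSum l d k) + mulC l d (alphaCoeff d j k))

/-- In the coefficient of `a_k` in the difference of the two sides of the formula for
`[α_i_λ α_j]`, the cofactor of `λ_i`. -/
def bracketZ (l d w : Fin 4 ⊕ Fin 4 → A) (h : A) (j k : Fin 4 ⊕ Fin 4) : A :=
  mulB (cubicOf l) w (alphaCoeff w j k) + signIf (j.isRight && k.isRight) (cubicDual l k * h) +
    (cubicOf l j * (alphaSum l d k + alphaSum l d k) +
    -(l j * (alphaSum (cubicOf l) d k + (alphaSum (cubicOf l) d k + alphaSum (cubicOf l) d k)) +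
      mulB (cubicOf l) d (alphaCoeff d j k)))

end Expressions

/-! ### Kernel evaluation of the representative cases -/

namespace SuperTree

noncomputable section

/-- The variables `λ_i` and `∂_i`. -/
def vars (b : Bool) : Fin 4 ⊕ Fin 4 → SuperTree
  | .inl k => forceNat (bif b then 12 + k else 8 + k) var
  | .inr k => forceNat (bif b then 4 + k else k) var

/-- The variables `λ_i + ∂_i`. -/
def varsAdd (i : Fin 4 ⊕ Fin 4) : SuperTree := vars false i + vars true i

/-- The test of the coefficient of `a_k` in the formula for `[α_i_λ α_j]`. -/
def bracketTest (j k : Fin 4 ⊕ Fin 4) : Bool :=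
  force (mulAlpha varsAdd (vars false) j (const 1)) fun h =>
  force (bracketY (vars false) (vars true) varsAdd h j k) fun Y =>
  force (bracketZ (vars false) (vars true) varsAdd h j k) fun Z =>
  force (mulB (vars false) (vars false) Y + Z) fun X =>
  let test (i : Fin 4 ⊕ Fin 4) : Bool :=
    isZero (vars false i * X + -(cubicOf (vars false) i * (Y + Y)))
  test (.inl 0) && test (.inl 1) && test (.inl 2) && test (.inl 3) &&
    test (.inr 0) && test (.inr 1) && test (.inr 2) && test (.inr 3)

/-- The eight cases represent all pairs (j, k) up to even permutations: each index is even or odd,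
and their positions among the four are equal or different. -/
lemma bracketTest_inl_inl_same : bracketTest (.inl 0) (.inl 0) = true := by decide +kernel
lemma bracketTest_inl_inl : bracketTest (.inl 0) (.inl 1) = true := by decide +kernel
lemma bracketTest_inl_inr_same : bracketTest (.inl 0) (.inr 0) = true := by decide +kernel
lemma bracketTest_inl_inr : bracketTest (.inl 0) (.inr 1) = true := by decide +kernel
lemma bracketTest_inr_inl_same : bracketTest (.inr 0) (.inl 0) = true := by decide +kernel
lemma bracketTest_inr_inl : bracketTest (.inr 0) (.inl 1) = true := by decide +kernel
lemma bracketTest_inr_inr_same : bracketTest (.inr 0) (.inr 0) = true := by decide +kernel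
lemma bracketTest_inr_inr : bracketTest (.inr 0) (.inr 1) = true := by decide +kernel

end

end SuperTree

/-! ### Transfer of the tests to super commuting families -/

/-- The two families `y false` and `y true` satisfy the relations of super polynomials of type
`(4, 4)` in two sets of variables. -/
structure IsSuperPair {A : Type*} [Ring A] (y : Bool → Fin 4 ⊕ Fin 4 → A) : Prop where
  comm : ∀ b c i j, y b i * y c j = signIf (i.isRight && j.isRight) (y c j * y b i)
  sq : ∀ b k, y b (.inr k) * y b (.inr k) = 0

namespace SuperTree

variable {A : Type*} [Ring A] (y : Bool → Fin 4 ⊕ Fin 4 → A)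

/-- The enumeration of the variables of a pair of families that is used by `SuperTree.vars`. -/
def enum (v : ℕ) : A :=
  if v < 16 then
    y (decide (4 ≤ v % 8)) (if v < 8 then .inr (Fin.ofNat 4 v) else .inl (Fin.ofNat 4 v))
  else 0

variable {y}

/-- Numbers from 16 on are assigned the value 0, so the relations required for all natural numbers
hold there trivially. The numbers below 8 are exactly the odd variables. -/
lemma IsSuperPair.isSuper (hy : IsSuperPair y) : IsSuper (enum y) where
  comm v w := by
    by_cases hv : v < 16
    · by_cases hw : w < 16
      · simp only [enum, hv, hw, if_true]
        rw [hy.comm]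
        by_cases h1 : v < 8 <;> by_cases h2 : w < 8 <;> simp [h1, h2, signIf]
      · simp [enum, hw]
    · simp [enum, hv]
  sq v hv := by
    have hv' : v < 16 := by omega
    simp only [enum, hv, hv', if_true]
    exact hy.sq _ _

lemma eval_vars (b : Bool) (i : Fin 4 ⊕ Fin 4) : eval (enum y) (vars b i) = y b i := by
  rcases i with k | k <;> cases b <;> fin_cases k <;>
    simp [vars, forceNat_eq, enum]
  rfl

section

variable (u v : Fin 4 ⊕ Fin 4 → SuperTree) {x : ℕ → A}

lemma eval_mul' (hx : IsSuper x) (s t : SuperTree) : eval x (s * t) = eval x s * eval x t :=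
  eval_mul hx s t

lemma eval_mulB (hx : IsSuper x) (r : SuperTree) : eval x (mulB u v r) =
    mulB (fun i => eval x (u i)) (fun i => eval x (v i)) (eval x r) := by
  simp only [mulB, eval_add', eval_mul' hx]

lemma eval_mulC (hx : IsSuper x) (r : SuperTree) : eval x (mulC u v r) =
    mulC (fun i => eval x (u i)) (fun i => eval x (v i)) (eval x r) := by
  simp only [mulC, eval_mulB _ _ hx, eval_add', eval_mul' hx]

lemma eval_cubicOf (hx : IsSuper x) (i : Fin 4 ⊕ Fin 4) :
    eval x (cubicOf u i) = cubicOf (fun i => eval x (u i)) i := by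
  rcases i with k | k
  · fin_cases k <;> simp [cubicOf, eval_mul' hx]
  · simp [cubicOf]

lemma eval_cubicDual (hx : IsSuper x) (i : Fin 4 ⊕ Fin 4) :
    eval x (cubicDual u i) = cubicDual (fun i => eval x (u i)) i := by
  rcases i with k | k <;> simp [cubicDual, eval_cubicOf _ hx]

lemma eval_mulPhi (hx : IsSuper x) (i : Fin 4 ⊕ Fin 4) (r : SuperTree) :
    eval x (mulPhi u i r) = mulPhi (fun i => eval x (u i)) i (eval x r) := by
  simp only [mulPhi, eval_mulB _ _ hx, eval_add', eval_neg', eval_mul' hx, eval_cubicOf _ hx]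

lemma eval_alphaCoeff (hx : IsSuper x) (i k : Fin 4 ⊕ Fin 4) :
    eval x (alphaCoeff u i k) = alphaCoeff (fun i => eval x (u i)) i k := by
  simp only [alphaCoeff, eval_mulPhi _ hx, eval_add', eval_mul' hx, eval_cubicDual _ hx]

lemma eval_mulAlpha (hx : IsSuper x) (i : Fin 4 ⊕ Fin 4) (r : SuperTree) :
    eval x (mulAlpha u v i r) =
      mulAlpha (fun i => eval x (u i)) (fun i => eval x (v i)) i (eval x r) := by
  simp only [mulAlpha, eval_mulPhi _ hx, eval_mulB _ _ hx, eval_mulC _ _ hx, eval_add',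
    eval_mul' hx, eval_cubicOf _ hx]

lemma eval_alphaSum (hx : IsSuper x) (k : Fin 4 ⊕ Fin 4) :
    eval x (alphaSum v u k) = alphaSum (fun i => eval x (v i)) (fun i => eval x (u i)) k := by
  simp only [alphaSum, sumAll, eval_alphaCoeff _ hx, eval_add', eval_mul' hx]

lemma eval_signIf (s : Bool) (t : SuperTree) : eval x (signIf s t) = signIf s (eval x t) := by
  cases s <;> simp [signIf]

lemma eval_bracketY (hx : IsSuper x) (w : Fin 4 ⊕ Fin 4 → SuperTree) (h : SuperTree)
    (j k : Fin 4 ⊕ Fin 4) : eval x (bracketY u v w h j k) =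
      bracketY (fun i => eval x (u i)) (fun i => eval x (v i)) (fun i => eval x (w i))
        (eval x h) j k := by
  simp only [bracketY, eval_add', eval_neg', eval_mulC _ _ hx, eval_signIf, eval_mul' hx,
    eval_alphaSum _ _ hx, eval_alphaCoeff _ hx]

lemma eval_bracketZ (hx : IsSuper x) (w : Fin 4 ⊕ Fin 4 → SuperTree) (h : SuperTree)
    (j k : Fin 4 ⊕ Fin 4) : eval x (bracketZ u v w h j k) =
      bracketZ (fun i => eval x (u i)) (fun i => eval x (v i)) (fun i => eval x (w i))
        (eval x h) j k := by
  simp only [bracketZ, eval_add', eval_neg', eval_mulB _ _ hx, eval_signIf, eval_mul' hx,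
    eval_alphaSum _ _ hx, eval_alphaCoeff _ hx, eval_cubicOf _ hx, eval_cubicDual _ hx]

end

end SuperTree

section

open SuperTree

variable {A : Type*} [Ring A]

/-- The coefficient of `a_k` in the difference of the two sides of the formula for
`[α_i_λ α_j]`. -/
def bracketDiff (y : Bool → Fin 4 ⊕ Fin 4 → A) (i j k : Fin 4 ⊕ Fin 4) : A :=
  mulPhi (y false) i (bracketY (y false) (y true) (y false + y true)
    (mulAlpha (y false + y true) (y false) j 1) j k) +
  y false i * bracketZ (y false) (y true) (y false + y true)
    (mulAlpha (y false + y true) (y false) j 1) j k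

variable {y : Bool → Fin 4 ⊕ Fin 4 → A}

/-- The test regroups φ_i Y + λ_i Z as λ_i (B_{λλ} Y + Z) - 2 μ_i Y, so that the expensive factors
are shared by all eight values of i. -/
lemma bracketDiff_eq_zero_of_test (hy : IsSuperPair y) {j k : Fin 4 ⊕ Fin 4}
    (h : bracketTest j k = true) (i : Fin 4 ⊕ Fin 4) : bracketDiff y i j k = 0 := by
  have hx := IsSuperPair.isSuper hy
  have h' : isZero (vars false i *
      (mulB (vars false) (vars false) (bracketY (vars false) (vars true) varsAdd
        (mulAlpha varsAdd (vars false) j (const 1)) j k) +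
        bracketZ (vars false) (vars true) varsAdd
        (mulAlpha varsAdd (vars false) j (const 1)) j k) +
      -(cubicOf (vars false) i * (bracketY (vars false) (vars true) varsAdd
        (mulAlpha varsAdd (vars false) j (const 1)) j k +
        bracketY (vars false) (vars true) varsAdd
        (mulAlpha varsAdd (vars false) j (const 1)) j k))) = true := by
    simp only [bracketTest, force_eq, Bool.and_eq_true] at h
    obtain ⟨⟨⟨⟨⟨⟨⟨h0, h1⟩, h2⟩, h3⟩, h4⟩, h5⟩, h6⟩, h7⟩ := h
    rcases i with i | i <;> fin_cases i <;> assumption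
  have h2 := eval_eq_zero (enum y) h'
  have hw : (fun i => y false i + y true i) = y false + y true := rfl
  simp only [eval_add', eval_neg', eval_mul' hx, eval_mulB _ _ hx, eval_bracketY _ _ hx,
    eval_bracketZ _ _ hx, eval_cubicOf _ hx, eval_mulAlpha _ _ hx, varsAdd, eval_vars, hw,
    eval_const, Int.cast_one] at h2
  eta_reduce at h2
  rw [bracketDiff, mulPhi, ← h2, mul_add (y false i)]
  abel

/-! ### Symmetry under even permutations of the four indices -/

/-- The renumbering of both the even and the odd indices by a permutation. -/
def renumber (g : Equiv.Perm (Fin 4)) : Equiv.Perm (Fin 4 ⊕ Fin 4) := Equiv.sumCongr g g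

lemma isRight_renumber (g : Equiv.Perm (Fin 4)) (i : Fin 4 ⊕ Fin 4) :
    (renumber g i).isRight = i.isRight := by rcases i with i | i <;> rfl

lemma swap_renumber (g : Equiv.Perm (Fin 4)) (i : Fin 4 ⊕ Fin 4) :
    (renumber g i).swap = renumber g i.swap := by rcases i with i | i <;> rfl

lemma IsSuperPair.renumber (hy : IsSuperPair y) (g : Equiv.Perm (Fin 4)) :
    IsSuperPair (fun b => y b ∘ renumber g) where
  comm b c i j := by
    simp only [Function.comp_apply]
    rw [hy.comm, isRight_renumber, isRight_renumber]
  sq b k := hy.sq b (g k)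

/-- This makes w = λ + ∂ a member of a super pair, so that the symmetry of the cubic expressions
applies to w as well. -/
lemma IsSuperPair.add (hy : IsSuperPair y) :
    IsSuperPair (fun b => bif b then y true else y false + y true) where
  comm b c i j := by
    have h := fun b c => hy.comm b c i j
    generalize (i.isRight && j.isRight) = s at *
    cases b <;> cases c <;> cases s <;>
      simp only [cond_true, cond_false, Pi.add_apply, signIf, add_mul, mul_add, h] <;> abel
  sq b k := by
    have h := hy.comm true false (.inr k) (.inr k)
    cases b
    · simp only [cond_false, Pi.add_apply, add_mul, mul_add, hy.sq, h]
      simp [signIf]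
    · exact hy.sq _ _

/-- The cubics are the derivatives of the product of the four odd variables. A permutation changes
that product by its sign, hence the restriction to even permutations. -/
lemma cubicTest : ∀ g : Equiv.Perm (Fin 4), Equiv.Perm.sign g = 1 → ∀ k : Fin 4,
    isZero (cubicOf (fun i => vars false (renumber g i)) (.inl k) +
      -cubicOf (vars false) (.inl (g k))) = true := by
  decide +kernel

lemma exists_even_perm_same : ∀ a : Fin 4, ∃ g : Equiv.Perm (Fin 4),
    Equiv.Perm.sign g = 1 ∧ g 0 = a := by
  decide +kernel

/-- Double transitivity of the alternating group on four letters: a permutation with prescribed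
values at 0 and 1 can be made even by exchanging its two remaining values. -/
lemma exists_even_perm : ∀ a b : Fin 4, a ≠ b → ∃ g : Equiv.Perm (Fin 4),
    Equiv.Perm.sign g = 1 ∧ g 0 = a ∧ g 1 = b := by
  decide +kernel

lemma cubicOf_renumber (hy : IsSuperPair y) {g : Equiv.Perm (Fin 4)} (hg : Equiv.Perm.sign g = 1)
    (b : Bool) : cubicOf (y b ∘ renumber g) = cubicOf (y b) ∘ renumber g := by
  -- The tests are stated for the family numbered `false`; the `xor` moves the family `y b` into
  -- that place.
  have hy' : IsSuperPair (fun c => y (xor b c)) := ⟨fun _ _ => hy.comm _ _, fun _ => hy.sq _⟩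
  have hx := IsSuperPair.isSuper hy'
  funext i
  rcases i with k | k
  · have h := eval_eq_zero (enum (fun c => y (xor b c))) (cubicTest g hg k)
    simp only [eval_add', eval_neg', eval_cubicOf _ hx, eval_vars, Bool.xor_false] at h
    exact add_neg_eq_zero.mp h
  · rfl

lemma mulB_eq_sum (u v : Fin 4 ⊕ Fin 4 → A) (r : A) :
    mulB u v r = ∑ k, u (.inl k) * (v (.inr k) * r) := by
  rw [mulB, Fin.sum_univ_four]
  abel

lemma mulC_eq_sum (u v : Fin 4 ⊕ Fin 4 → A) (r : A) :
    mulC u v r = ∑ n, u n * (v n.swap * r) := by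
  rw [mulC, mulB, Fintype.sum_sum_type, Fin.sum_univ_four, Fin.sum_univ_four]
  simp only [Sum.swap_inl, Sum.swap_inr]
  abel

lemma sumAll_eq_sum (f : Fin 4 ⊕ Fin 4 → A) : sumAll f = ∑ n, f n := by
  rw [sumAll, Fintype.sum_sum_type, Fin.sum_univ_four, Fin.sum_univ_four]
  abel

section Renumber

variable (g : Equiv.Perm (Fin 4)) (u v : Fin 4 ⊕ Fin 4 → A)

lemma mulB_renumber (r : A) : mulB (u ∘ renumber g) (v ∘ renumber g) r = mulB u v r := by
  rw [mulB_eq_sum, mulB_eq_sum]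
  exact Equiv.sum_comp g fun k => u (.inl k) * (v (.inr k) * r)

lemma mulC_renumber (r : A) : mulC (u ∘ renumber g) (v ∘ renumber g) r = mulC u v r := by
  rw [mulC_eq_sum, mulC_eq_sum, ← Equiv.sum_comp (renumber g) fun n => u n * (v n.swap * r)]
  simp only [Function.comp_apply, swap_renumber]

variable {g u}

lemma cubicDual_renumber (hu : cubicOf (u ∘ renumber g) = cubicOf u ∘ renumber g)
    (k : Fin 4 ⊕ Fin 4) :
    cubicDual (u ∘ renumber g) k = cubicDual u (renumber g k) := by
  rcases k with k | k
  · rfl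
  · exact congrFun hu (.inl k)

lemma mulPhi_renumber (hu : cubicOf (u ∘ renumber g) = cubicOf u ∘ renumber g)
    (i : Fin 4 ⊕ Fin 4) (r : A) :
    mulPhi (u ∘ renumber g) i r = mulPhi u (renumber g i) r := by
  simp only [mulPhi, mulB_renumber, hu, Function.comp_apply]

lemma alphaCoeff_renumber (hu : cubicOf (u ∘ renumber g) = cubicOf u ∘ renumber g)
    (i k : Fin 4 ⊕ Fin 4) :
    alphaCoeff (u ∘ renumber g) i k = alphaCoeff u (renumber g i) (renumber g k) := by
  simp only [alphaCoeff, mulPhi_renumber hu, cubicDual_renumber hu, Function.comp_apply,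
    swap_renumber]

lemma mulAlpha_renumber (hu : cubicOf (u ∘ renumber g) = cubicOf u ∘ renumber g)
    (i : Fin 4 ⊕ Fin 4) (r : A) :
    mulAlpha (u ∘ renumber g) (v ∘ renumber g) i r = mulAlpha u v (renumber g i) r := by
  simp only [mulAlpha, mulPhi_renumber hu, mulC_renumber, hu, mulB_renumber, Function.comp_apply]

lemma alphaSum_renumber (hu : cubicOf (u ∘ renumber g) = cubicOf u ∘ renumber g)
    (k : Fin 4 ⊕ Fin 4) :
    alphaSum (v ∘ renumber g) (u ∘ renumber g) k = alphaSum v u (renumber g k) := by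
  simp only [alphaSum, sumAll_eq_sum]
  rw [← Equiv.sum_comp (renumber g) fun n => v n * alphaCoeff u n.swap (renumber g k)]
  simp only [Function.comp_apply, swap_renumber, alphaCoeff_renumber hu]

end Renumber

/-- B and C are sums over all indices and are invariant under any renumbering. Evenness of g enters
only through the cubics of λ, ∂ and λ + ∂. -/
lemma bracketDiff_renumber (hy : IsSuperPair y) {g : Equiv.Perm (Fin 4)}
    (hg : Equiv.Perm.sign g = 1) (i j k : Fin 4 ⊕ Fin 4) :
    bracketDiff (fun b => y b ∘ renumber g) i j k =
      bracketDiff y (renumber g i) (renumber g j) (renumber g k) := by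
  have hl := cubicOf_renumber hy hg false
  have hd := cubicOf_renumber hy hg true
  have hw := cubicOf_renumber hy.add hg false
  simp only [cond_false] at hw
  have hadd : y false ∘ renumber g + y true ∘ renumber g = (y false + y true) ∘ renumber g := rfl
  simp only [bracketDiff, bracketY, bracketZ, hadd, mulPhi_renumber hl, hl, mulC_renumber,
    mulB_renumber, alphaCoeff_renumber hd, alphaCoeff_renumber hw, mulAlpha_renumber _ hw,
    alphaSum_renumber _ hd, cubicDual_renumber hl, Function.comp_apply, swap_renumber,
    isRight_renumber]

theorem bracketDiff_eq_zero (hy : IsSuperPair y) (i j k : Fin 4 ⊕ Fin 4) :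
    bracketDiff y i j k = 0 := by
  have key : ∀ (g : Equiv.Perm (Fin 4)) (j' k' : Fin 4 ⊕ Fin 4), Equiv.Perm.sign g = 1 →
      bracketTest j' k' = true → renumber g j' = j → renumber g k' = k →
      bracketDiff y i j k = 0 := by
    rintro g j' k' hg ht rfl rfl
    -- Only j and k are moved to representatives. The index i may become anything, since each test
    -- covers all eight values of it.
    have h := bracketDiff_renumber hy hg ((renumber g).symm i) j' k'
    rw [Equiv.apply_symm_apply] at h
    rw [← h]
    exact bracketDiff_eq_zero_of_test (hy.renumber g) ht _
  rcases j with a | a <;> rcases k with b | b <;> by_cases hab : a = b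
  · subst hab
    obtain ⟨g, hg, rfl⟩ := exists_even_perm_same a
    exact key g (.inl 0) (.inl 0) hg bracketTest_inl_inl_same rfl rfl
  · obtain ⟨g, hg, rfl, rfl⟩ := exists_even_perm a b hab
    exact key g (.inl 0) (.inl 1) hg bracketTest_inl_inl rfl rfl
  · subst hab
    obtain ⟨g, hg, rfl⟩ := exists_even_perm_same a
    exact key g (.inl 0) (.inr 0) hg bracketTest_inl_inr_same rfl rfl
  · obtain ⟨g, hg, rfl, rfl⟩ := exists_even_perm a b hab
    exact key g (.inl 0) (.inr 1) hg bracketTest_inl_inr rfl rfl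
  · subst hab
    obtain ⟨g, hg, rfl⟩ := exists_even_perm_same a
    exact key g (.inr 0) (.inl 0) hg bracketTest_inr_inl_same rfl rfl
  · obtain ⟨g, hg, rfl, rfl⟩ := exists_even_perm a b hab
    exact key g (.inr 0) (.inl 1) hg bracketTest_inr_inl rfl rfl
  · subst hab
    obtain ⟨g, hg, rfl⟩ := exists_even_perm_same a
    exact key g (.inr 0) (.inr 0) hg bracketTest_inr_inr_same rfl rfl
  · obtain ⟨g, hg, rfl, rfl⟩ := exists_even_perm a b hab
    exact key g (.inr 0) (.inr 1) hg bracketTest_inr_inr rfl rfl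

end

/-! ### Signs, twists and the grading of super polynomials -/

lemma zmod_two_cases (ε : ZMod 2) : ε = 0 ∨ ε = 1 := by
  fin_cases ε
  · exact Or.inl rfl
  · exact Or.inr rfl

section ParSign

variable (F : Type*) [Field F]

@[simp]
lemma parSign_zero : parSign F 0 = 1 := by simp [parSign]

@[simp]
lemma parSign_one : parSign F 1 = -1 := by simp [parSign, ZMod.val_one]

lemma parSign_add (a b : ZMod 2) : parSign F (a + b) = parSign F a * parSign F b := by
  have h : (1 + 1 : ZMod 2) = 0 := rfl
  rcases zmod_two_cases a with rfl | rfl <;> rcases zmod_two_cases b with rfl | rfl <;>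
    simp [h]

end ParSign

namespace SuperPoly

noncomputable section

variable {F : Type*} [Field F] {ι : Type*} {p : ι → ZMod 2}

lemma hom_ext {B : Type*} [Ring B] [Algebra F B] {f g : SuperPoly F p →ₐ[F] B}
    (h : ∀ i, f (X i) = g (X i)) : f = g :=
  RingQuot.ringQuot_ext' _ _ _ (FreeAlgebra.hom_ext (funext h))

/-- The elements that map N into itself form a subalgebra. It contains the variables, and these
generate. -/
lemma smul_mem_of_X_smul_mem {M : Type*} [AddCommGroup M] [Module F M] [Module (SuperPoly F p) M]
    [IsScalarTower F (SuperPoly F p) M] {N : Submodule F M}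
    (h : ∀ i, ∀ m ∈ N, (X i : SuperPoly F p) • m ∈ N) (P : SuperPoly F p) {m : M} (hm : m ∈ N) :
    P • m ∈ N := by
  let π : FreeAlgebra F ι →ₐ[F] SuperPoly F p := RingQuot.mkAlgHom F (SuperPolyRel F p)
  obtain ⟨a, rfl⟩ : ∃ a, π a = P := RingQuot.mkAlgHom_surjective F (SuperPolyRel F p) P
  induction a using FreeAlgebra.induction generalizing m with
  | grade0 r =>
    rw [AlgHom.commutes]
    rw [algebraMap_smul]
    exact N.smul_mem r hm
  | grade1 i => exact h i m hm
  | mul a b ha hb =>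
    rw [map_mul, mul_smul]
    exact ha (hb hm)
  | add a b ha hb =>
    rw [map_add, add_smul]
    exact N.add_mem (ha hm) (hb hm)

lemma induction_X_mul {C : SuperPoly F p → Prop} (one : C 1) (add : ∀ P Q, C P → C Q → C (P + Q))
    (smul : ∀ (t : F) P, C P → C (t • P)) (X_mul : ∀ i P, C P → C (X i * P)) (P : SuperPoly F p) :
    C P := by
  let N : Submodule F (SuperPoly F p) :=
    { carrier := {P | C P}
      add_mem' := fun hP hQ => add _ _ hP hQ
      zero_mem' := by simpa using smul 0 _ one
      smul_mem' := fun t _ hP => smul t _ hP }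
  have h := smul_mem_of_X_smul_mem (N := N) (fun i m (hm : C m) => (X_mul i m hm : C (X i • m))) P
    (m := 1) one
  rwa [smul_eq_mul, mul_one] at h

@[simp]
lemma twist_X (ε : ZMod 2) (i : ι) :
    twist ε (X i : SuperPoly F p) = parSign F (ε * p i) • X i := lift_X _ _ _

@[simp]
lemma neg_X (i : ι) : neg (X i : SuperPoly F p) = -X i := lift_X _ _ _

@[simp]
lemma inl_X (i : ι) : inl (X i : SuperPoly F p) = X (Sum.inl i) := lift_X _ _ _

@[simp]
lemma inr_X (i : ι) : inr (X i : SuperPoly F p) = X (Sum.inr i) := lift_X _ _ _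

@[simp]
lemma inAdd_X (i : ι) : inAdd (X i : SuperPoly F p) = X (Sum.inl i) + X (Sum.inr i) :=
  lift_X _ _ _

lemma twist_add (ε δ : ZMod 2) (P : SuperPoly F p) : twist (ε + δ) P = twist ε (twist δ P) := by
  refine DFunLike.congr_fun (f := twist (ε + δ)) (g := (twist ε).comp (twist δ))
    (hom_ext fun i => ?_) P
  simp only [AlgHom.comp_apply, twist_X, map_smul, smul_smul, add_mul, parSign_add]
  rw [mul_comm]

lemma twist_inl (ε : ZMod 2) (P : SuperPoly F p) : twist ε (inl P) = inl (twist ε P) := by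
  refine DFunLike.congr_fun (f := (twist ε).comp inl) (g := inl.comp (twist ε))
    (hom_ext fun i => ?_) P
  simp

lemma twist_inr (ε : ZMod 2) (P : SuperPoly F p) : twist ε (inr P) = inr (twist ε P) := by
  refine DFunLike.congr_fun (f := (twist ε).comp inr) (g := inr.comp (twist ε))
    (hom_ext fun i => ?_) P
  simp

lemma twist_inAdd (ε : ZMod 2) (P : SuperPoly F p) : twist ε (inAdd P) = inAdd (twist ε P) := by
  refine DFunLike.congr_fun (f := (twist ε).comp inAdd) (g := inAdd.comp (twist ε))
    (hom_ext fun i => ?_) P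
  simp

/-- An element that super commutes with the images of the variables super commutes with the
images of all super polynomials. -/
lemma superComm_hom {B : Type*} [Ring B] [Algebra F B] (f : SuperPoly F p →ₐ[F] B) (ε : ZMod 2)
    (T : B) (h : ∀ j, T * f (X j) = parSign F (ε * p j) • (f (X j) * T)) (P : SuperPoly F p) :
    T * f P = f (twist ε P) * T := by
  induction P using induction_X_mul with
  | one => simp
  | add P Q hP hQ => simp only [map_add, mul_add, add_mul, hP, hQ]
  | smul t P hP => simp only [map_smul, mul_smul_comm, smul_mul_assoc, hP]
  | X_mul j P hP =>
    rw [map_mul, map_mul, ← mul_assoc, h, twist_X, map_mul, map_smul, smul_mul_assoc,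
      smul_mul_assoc, smul_mul_assoc, mul_assoc, hP, mul_assoc]

lemma X_mul_eq (i : ι) (P : SuperPoly F p) : X i * P = twist (p i) P * X i :=
  superComm_hom (AlgHom.id F _) (p i) (X i) (fun j => X_mul_X i j) P

lemma twist_of_mem_homog {γ : ZMod 2} {P : SuperPoly F p} (hP : P ∈ homog F p γ) (ε : ZMod 2) :
    twist ε P = parSign F (ε * γ) • P := by
  induction hP using Submodule.span_induction with
  | mem P h =>
    obtain ⟨K, rfl, rfl⟩ := h
    induction K with
    | nil => simp
    | cons i K ih =>
      simp only [List.map_cons, List.prod_cons, List.sum_cons, map_mul, twist_X, ih, mul_add,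
        parSign_add, smul_mul_smul_comm]
  | zero => simp
  | add P Q _ _ hP hQ => rw [map_add, hP, hQ, smul_add]
  | smul t P _ hP => rw [map_smul, hP, smul_comm]

lemma X_mul_mem_homog (i : ι) {γ : ZMod 2} {P : SuperPoly F p} (hP : P ∈ homog F p γ) :
    X i * P ∈ homog F p (p i + γ) := by
  induction hP using Submodule.span_induction with
  | mem P h =>
    obtain ⟨K, rfl, rfl⟩ := h
    exact Submodule.subset_span ⟨i :: K, by simp, by simp⟩
  | zero => simp
  | add P Q _ _ hP hQ => rw [mul_add]; exact add_mem hP hQ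
  | smul t P _ hP => rw [mul_smul_comm]; exact Submodule.smul_mem _ t hP

lemma one_mem_homog : (1 : SuperPoly F p) ∈ homog F p 0 := Submodule.subset_span ⟨[], rfl, rfl⟩

lemma X_mem_homog (i : ι) : (X i : SuperPoly F p) ∈ homog F p (p i) := by
  simpa using X_mul_mem_homog i (one_mem_homog (F := F) (p := p))

lemma exists_homog_add (P : SuperPoly F p) : P ∈ homog F p 0 ⊔ homog F p 1 := by
  have h := smul_mem_of_X_smul_mem (N := homog F p 0 ⊔ homog F p 1) ?_ P
    (Submodule.mem_sup_left one_mem_homog)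
  · rwa [smul_eq_mul, mul_one] at h
  · intro i m hm
    obtain ⟨a, ha, b, hb, rfl⟩ := Submodule.mem_sup.mp hm
    rw [smul_eq_mul, mul_add]
    have h1 := X_mul_mem_homog i ha
    have h2 := X_mul_mem_homog i hb
    rcases zmod_two_cases (p i) with h | h <;> rw [h] at h1 h2
    · exact add_mem (Submodule.mem_sup_left h1) (Submodule.mem_sup_right h2)
    · exact add_mem (Submodule.mem_sup_right h1) (Submodule.mem_sup_left h2)

/-- The twist by 1 acts as 1 on even and as -1 on odd elements, so a common element is killed by 2.
No basis of monomials is needed. -/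
lemma isCompl_homog [CharZero F] : IsCompl (homog F p 0) (homog F p 1) := by
  constructor
  · rw [Submodule.disjoint_def]
    intro P h0 h1
    have e0 := twist_of_mem_homog h0 1
    have e1 := twist_of_mem_homog h1 1
    rw [e0] at e1
    simp only [mul_zero, parSign_zero, one_smul, mul_one, parSign_one, neg_smul] at e1
    have h2 : (2 : F) • P = 0 := by
      rw [two_smul]
      nth_rewrite 1 [e1]
      exact neg_add_cancel _
    exact (smul_eq_zero_iff_right (two_ne_zero : (2 : F) ≠ 0)).mp h2
  · rw [codisjoint_iff, eq_top_iff]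
    exact fun P _ => exists_homog_add P

end

end SuperPoly

/-! ### Sesquilinearity for the two-variable extension of a bracket -/

namespace LieConformal

open SuperPoly

noncomputable section

section Modules

variable {F : Type*} [Field F] {ι : Type*} {p : ι → ZMod 2}
  {R : Type*} [AddCommGroup R] [Module F R]

lemma lamOp_eq_smul (i : ι) (t : SuperPoly F p ⊗[F] R) : lamOp i t = (X i : SuperPoly F p) • t := by
  induction t with
  | zero => simp
  | tmul P c => rfl
  | add x y hx hy => rw [map_add, smul_add, hx, hy]

section Extend

variable (f g : SuperPoly F p →ₐ[F] SuperPoly F (Sum.elim p p))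
  (T T' : R →ₗ[F] SuperPoly F p ⊗[F] R)

lemma rTensor_smul (P : SuperPoly F p) (t : SuperPoly F p ⊗[F] R) :
    LinearMap.rTensor R f.toLinearMap (P • t) = f P • LinearMap.rTensor R f.toLinearMap t := by
  induction t with
  | zero => simp
  | tmul Q c => simp [TensorProduct.smul_tmul']
  | add x y hx hy => simp only [smul_add, map_add, hx, hy]

@[simp]
lemma extend_tmul (P : SuperPoly F p) (c : R) :
    extend f g T (P ⊗ₜ c) = g P • LinearMap.rTensor R f.toLinearMap (T c) := rfl

lemma extend_add (t : SuperPoly F p ⊗[F] R) :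
    extend f g (T + T') t = extend f g T t + extend f g T' t := by
  induction t with
  | zero => simp
  | tmul Q c => simp
  | add x y hx hy => rw [map_add, map_add, map_add, hx, hy]; abel

lemma extend_smul (s : F) (t : SuperPoly F p ⊗[F] R) :
    extend f g (s • T) t = s • extend f g T t := by
  induction t with
  | zero => simp
  | tmul Q c => simp [smul_comm s]
  | add x y hx hy => rw [map_add, map_add, smul_add, hx, hy]

lemma extend_zero (t : SuperPoly F p ⊗[F] R) :
    extend f g (0 : R →ₗ[F] SuperPoly F p ⊗[F] R) t = 0 := by
  simpa using extend_smul f g 0 0 t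

lemma extend_smul_apply (P : SuperPoly F p) (t : SuperPoly F p ⊗[F] R) :
    extend f g T (P • t) = g P • extend f g T t := by
  induction t with
  | zero => simp
  | tmul Q c => simp [TensorProduct.smul_tmul', mul_smul]
  | add x y hx hy => rw [smul_add, map_add, map_add, smul_add, hx, hy]

lemma extend_lamOp (i : ι) (t : SuperPoly F p ⊗[F] R) :
    extend f g T (lamOp i t) = g (X i) • extend f g T t := by
  rw [lamOp_eq_smul, extend_smul_apply]

end Extend

variable [Module (SuperPoly F p) R] [IsScalarTower F (SuperPoly F p) R]

/-- The left action of `∂_i` on `F[λ, μ] ⊗ R`. -/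
def parOp₂ (i : ι) : Module.End F (SuperPoly F (Sum.elim p p) ⊗[F] R) :=
  TensorProduct.map (twist (p i)).toLinearMap (Module.toModuleEnd F R (X i : SuperPoly F p))

@[simp]
lemma parOp₂_tmul (i : ι) (P : SuperPoly F (Sum.elim p p)) (c : R) :
    parOp₂ (p := p) i (P ⊗ₜ[F] c) = twist (p i) P ⊗ₜ ((X i : SuperPoly F p) • c) :=
  rfl

lemma parOp_smul (i : ι) (P : SuperPoly F p) (t : SuperPoly F p ⊗[F] R) :
    parOp i (P • t) = twist (p i) P • parOp i t := by
  induction t with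
  | zero => simp
  | tmul Q c => simp [TensorProduct.smul_tmul']
  | add x y hx hy => simp only [smul_add, map_add, hx, hy]

lemma parOp₂_smul (i : ι) (P : SuperPoly F (Sum.elim p p))
    (t : SuperPoly F (Sum.elim p p) ⊗[F] R) :
    parOp₂ (p := p) i (P • t) = twist (p i) P • parOp₂ i t := by
  induction t with
  | zero => simp
  | tmul Q c => simp [TensorProduct.smul_tmul']
  | add x y hx hy => simp only [smul_add, map_add, hx, hy]

lemma lamOp_smul (i : ι) (P : SuperPoly F p) (t : SuperPoly F p ⊗[F] R) :
    lamOp i (P • t) = twist (p i) P • lamOp i t := by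
  rw [lamOp_eq_smul, lamOp_eq_smul, smul_smul, smul_smul, X_mul_eq]

section RTensor

variable (f : SuperPoly F p →ₐ[F] SuperPoly F (Sum.elim p p))

lemma rTensor_parOp (hf : ∀ ε P, twist ε (f P) = f (twist ε P)) (i : ι)
    (t : SuperPoly F p ⊗[F] R) :
    LinearMap.rTensor R f.toLinearMap (parOp i t) =
      parOp₂ i (LinearMap.rTensor R f.toLinearMap t) := by
  induction t with
  | zero => simp
  | tmul Q c => simp [hf]
  | add x y hx hy => simp only [map_add, hx, hy]

variable (g : SuperPoly F p →ₐ[F] SuperPoly F (Sum.elim p p))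
  (T T' : R →ₗ[F] SuperPoly F p ⊗[F] R)

variable {f g T T'}

/-- The rule for `extend` and a map with the sesquilinearity of `[a_λ ·]`. -/
lemma extend_parOp_right (hf : ∀ ε P, twist ε (f P) = f (twist ε P))
    (hg : ∀ ε P, twist ε (g P) = g (twist ε P)) (i : ι)
    (hX : ∀ Q, f (X i) * Q = twist (p i) Q * f (X i)) (s : F)
    (hT : ∀ c, T ((X i : SuperPoly F p) • c) = s • (parOp i (T c) + lamOp i (T c)))
    (t : SuperPoly F p ⊗[F] R) :
    extend f g T (parOp i t) = s • (parOp₂ i (extend f g T t) + f (X i) • extend f g T t) := by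
  induction t with
  | zero => simp
  | tmul Q c =>
    rw [parOp_tmul, extend_tmul, extend_tmul, hT, map_smul, map_add, rTensor_parOp f hf,
      lamOp_eq_smul, rTensor_smul, parOp₂_smul, smul_smul (f (X i)), hX, hg, mul_smul, ← smul_add,
      smul_comm]
  | add x y hx hy => simp only [map_add, smul_add, hx, hy]; abel

/-- The rule for `extend` and a map with the sesquilinearity of `[·_λ c]`. -/
lemma extend_parOp_left (hg : ∀ ε P, twist ε (g P) = g (twist ε P)) (i : ι)
    (hX : ∀ Q, f (X i) * Q = twist (p i) Q * f (X i))
    (hT : ∀ c, T ((X i : SuperPoly F p) • c) = -lamOp i (T c))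
    (t : SuperPoly F p ⊗[F] R) :
    extend f g T (parOp i t) = -(f (X i) • extend f g T t) := by
  induction t with
  | zero => simp
  | tmul Q c =>
    rw [parOp_tmul, extend_tmul, extend_tmul, hT, map_neg, lamOp_eq_smul, rTensor_smul,
      smul_smul (f (X i)), hX, hg, mul_smul, smul_neg]
  | add x y hx hy => simp only [map_add, smul_add, hx, hy]; abel

/-- The rule for `extend` when the argument `a` of `T = [a_λ ·]` is multiplied by `∂_i`. -/
lemma extend_map_left {g' : SuperPoly F p →ₐ[F] SuperPoly F (Sum.elim p p)}
    (hg : ∀ ε P, twist ε (g P) = g (twist ε P)) (i : ι)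
    (hg' : ∀ P, g' P = g (twist (p i) P))
    (hX : ∀ Q, f (X i) * Q = twist (p i) Q * f (X i))
    (hT : ∀ c, T' c = -lamOp i (T c)) (t : SuperPoly F p ⊗[F] R) :
    extend f g' T' t = -(f (X i) • extend f g T t) := by
  induction t with
  | zero => simp
  | tmul Q c =>
    rw [extend_tmul, extend_tmul, hT, map_neg, lamOp_eq_smul, rTensor_smul,
      smul_smul (f (X i)), hX, hg, mul_smul, smul_neg, hg']
  | add x y hx hy => simp only [map_add, smul_add, hx, hy]; abel

/-- The rule for `extend` when the argument `c` of `T = [·_λ c]` is multiplied by `∂_i`. -/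
lemma extend_map_right (hf : ∀ ε P, twist ε (f P) = f (twist ε P))
    (hg : ∀ ε P, twist ε (g P) = g (twist ε P)) (i : ι)
    (hX : ∀ Q, f (X i) * Q = twist (p i) Q * f (X i)) {gr : ZMod 2 → Submodule F R}
    (hT : ∀ δ, ∀ c ∈ gr δ, T' c = parSign F (p i * δ) • (parOp i (T c) + lamOp i (T c)))
    {η : ZMod 2} {t : SuperPoly F p ⊗[F] R} (ht : t ∈ tensorGr gr η) :
    extend f g T' t =
      parSign F (p i * η) • (parOp₂ i (extend f g T t) + f (X i) • extend f g T t) := by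
  induction ht using Submodule.span_induction with
  | zero => simp
  | mem t h =>
    obtain ⟨γ, δ, rfl, P, hP, c, hc, rfl⟩ := h
    -- For P ⊗ c with P of parity γ and c of parity δ, the rule for c contributes the sign of p_i δ
    -- and passing P contributes that of p_i γ. Together they depend only on the total parity.
    rw [extend_tmul, extend_tmul, hT δ c hc, map_smul, map_add, rTensor_parOp f hf,
      lamOp_eq_smul, rTensor_smul, parOp₂_smul, smul_smul (f (X i)), hX, hg,
      twist_of_mem_homog hP, mul_smul, ← smul_add, map_smul, smul_assoc, smul_smul, mul_add,
      parSign_add, mul_right_comm, parSign_mul_self, one_mul, smul_comm]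
  | add x y _ _ hx hy => simp only [map_add, smul_add, hx, hy]; abel
  | smul s x _ hx => rw [map_smul, map_smul, hx, map_smul, smul_comm s, smul_add, smul_comm _ s]

end RTensor

end Modules

end

end LieConformal

/-! ### Reduction of the axioms to homogeneous generators -/

namespace LieConformal

open SuperPoly

noncomputable section

section Generators

variable {F : Type*} [Field F] {ι : Type*} {p : ι → ZMod 2}
  {R : Type*} [AddCommGroup R] [Module F R] [Module (SuperPoly F p) R]
  [IsScalarTower F (SuperPoly F p) R]

@[simp]
lemma shift_X (t : F) (i : ι) :
    (shift t (X i : SuperPoly F p) : Module.End F (SuperPoly F p ⊗[F] R)) =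
      t • (lamOp i + parOp i) := lift_X _ _ _

lemma parOp_mul_shift (t : F) (i : ι) (P : SuperPoly F p) :
    (parOp i * shift t P : Module.End F (SuperPoly F p ⊗[F] R)) =
      shift t (twist (p i) P) * parOp i := by
  refine superComm_hom (shift t : SuperPoly F p →ₐ[F] Module.End F (SuperPoly F p ⊗[F] R)) (p i)
    (parOp i) (fun j => ?_) P
  rw [shift_X, mul_smul_comm, smul_mul_assoc, mul_add, add_mul, parOp_mul_lamOp,
    parOp_mul_parOp i j, ← smul_add, smul_comm]

lemma substNeg_tmul (P : SuperPoly F p) (c : R) :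
    substNeg (P ⊗ₜ[F] c) = shift (-1 : F) P (1 ⊗ₜ c) := rfl

lemma substNeg_lamOp (i : ι) (t : SuperPoly F p ⊗[F] R) :
    substNeg (lamOp i t) = -(parOp i (substNeg t) + lamOp i (substNeg t)) := by
  induction t with
  | zero => simp
  | tmul P c =>
    rw [lamOp_tmul, substNeg_tmul, map_mul, shift_X, substNeg_tmul]
    simp [add_comm]
  | add x y hx hy => simp only [map_add, hx, hy]; abel

lemma substNeg_parOp (i : ι) (t : SuperPoly F p ⊗[F] R) :
    substNeg (parOp i t) = parOp i (substNeg t) := by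
  induction t with
  | zero => simp
  | tmul P c =>
    rw [parOp_tmul, substNeg_tmul, substNeg_tmul, ← Module.End.mul_apply (parOp i),
      parOp_mul_shift, Module.End.mul_apply, parOp_tmul, map_one]
  | add x y hx hy => simp only [map_add, hx, hy]

lemma lamOp_mem_tensorGr {gr : ZMod 2 → Submodule F R} (i : ι) {η : ZMod 2}
    {t : SuperPoly F p ⊗[F] R} (ht : t ∈ tensorGr gr η) : lamOp i t ∈ tensorGr gr (p i + η) := by
  induction ht using Submodule.span_induction with
  | zero => simp
  | mem t h =>
    obtain ⟨γ, δ, rfl, P, hP, c, hc, rfl⟩ := h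
    exact Submodule.subset_span ⟨p i + γ, δ, by ring, _, X_mul_mem_homog i hP, c, hc, rfl⟩
  | add x y _ _ hx hy => rw [map_add]; exact add_mem hx hy
  | smul s x _ hx => rw [map_smul]; exact Submodule.smul_mem _ s hx

lemma parOp_mem_tensorGr {gr : ZMod 2 → Submodule F R}
    (hgr : ∀ (i : ι) (ε : ZMod 2) (a : R), a ∈ gr ε → (X i : SuperPoly F p) • a ∈ gr (p i + ε))
    (i : ι) {η : ZMod 2} {t : SuperPoly F p ⊗[F] R} (ht : t ∈ tensorGr gr η) :
    parOp i t ∈ tensorGr gr (p i + η) := by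
  induction ht using Submodule.span_induction with
  | zero => simp
  | mem t h =>
    obtain ⟨γ, δ, rfl, P, hP, c, hc, rfl⟩ := h
    refine Submodule.subset_span ⟨γ, p i + δ, by ring, _, ?_, _, hgr i δ c hc, rfl⟩
    change twist (p i) P ∈ _
    rw [twist_of_mem_homog hP]
    exact Submodule.smul_mem _ _ hP
  | add x y _ _ hx hy => rw [map_add]; exact add_mem hx hy
  | smul s x _ hx => rw [map_smul]; exact Submodule.smul_mem _ s hx

/-- The elements of parity `ε` of the submodule generated by elements `e k` of parity `q k`. -/
def homSpan {κ : Type*} (e : κ → R) (q : κ → ZMod 2) (ε : ZMod 2) : Submodule F R :=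
  Submodule.span F {a | ∃ (K : List ι) (k : κ), (K.map p).sum + q k = ε ∧
    (K.map (X : ι → SuperPoly F p)).prod • e k = a}

lemma homSpan_induction {κ : Type*} {e : κ → R} {q : κ → ZMod 2} {C : ZMod 2 → R → Prop}
    (zero : ∀ ε, C ε 0) (add : ∀ ε a b, C ε a → C ε b → C ε (a + b))
    (smul : ∀ ε (t : F) a, C ε a → C ε (t • a)) (gen : ∀ k, C (q k) (e k))
    (X_smul : ∀ i ε a, C ε a → C (p i + ε) ((X i : SuperPoly F p) • a)) {ε : ZMod 2} {a : R}
    (ha : a ∈ homSpan (F := F) (p := p) e q ε) : C ε a := by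
  induction ha using Submodule.span_induction with
  | zero => exact zero ε
  | mem a h =>
    obtain ⟨K, k, rfl, rfl⟩ := h
    induction K with
    | nil => simpa using gen k
    | cons i K ih =>
      simp only [List.map_cons, List.prod_cons, List.sum_cons, mul_smul, add_assoc]
      exact X_smul i _ _ ih
  | add a b _ _ ha hb => exact add ε a b ha hb
  | smul t a _ ha => exact smul ε t a ha

/-- The Jacobi identity for `a`, `b` of parities `ε`, `δ`. -/
def JacobiAt (br : R →ₗ[F] R →ₗ[F] SuperPoly F p ⊗[F] R) (ε δ : ZMod 2) (a b c : R) : Prop :=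
  extend inl (inr.comp (twist ε)) (br a) (br b c) =
    extend inAdd inl (br.flip c) (br a b) +
      parSign F (ε * δ) • extend inr (inl.comp (twist δ)) (br b) (br a c)

/-- The left action of `∂_i + λ_i + μ_i` on `F[λ, μ] ⊗ R`. -/
def totalOp (i : ι) : Module.End F (SuperPoly F (Sum.elim p p) ⊗[F] R) :=
  parOp₂ i + Algebra.lsmul F F _ (X (Sum.inl i) + X (Sum.inr i) : SuperPoly F (Sum.elim p p))

lemma totalOp_apply (i : ι) (t : SuperPoly F (Sum.elim p p) ⊗[F] R) :
    totalOp (p := p) i t = parOp₂ i t +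
      (X (Sum.inl i) + X (Sum.inr i) : SuperPoly F (Sum.elim p p)) • t := rfl

lemma inl_X_mul (i : ι) (Q : SuperPoly F (Sum.elim p p)) :
    inl (X i : SuperPoly F p) * Q = twist (p i) Q * inl (X i) := by
  rw [inl_X]
  exact X_mul_eq (Sum.inl i) Q

lemma inr_X_mul (i : ι) (Q : SuperPoly F (Sum.elim p p)) :
    inr (X i : SuperPoly F p) * Q = twist (p i) Q * inr (X i) := by
  rw [inr_X]
  exact X_mul_eq (Sum.inr i) Q

lemma inAdd_X_mul (i : ι) (Q : SuperPoly F (Sum.elim p p)) :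
    inAdd (X i : SuperPoly F p) * Q = twist (p i) Q * inAdd (X i) := by
  have h1 := X_mul_eq (Sum.inl i) Q
  have h2 := X_mul_eq (Sum.inr i) Q
  rw [inAdd_X, add_mul, mul_add, h1, h2]
  rfl

variable {gr : ZMod 2 → Submodule F R} {br : R →ₗ[F] R →ₗ[F] SuperPoly F p ⊗[F] R}

lemma JacobiAt.add_left {ε δ : ZMod 2} {a a' b c : R} (h : JacobiAt br ε δ a b c)
    (h' : JacobiAt br ε δ a' b c) : JacobiAt br ε δ (a + a') b c := by
  unfold JacobiAt at *
  simp only [map_add, LinearMap.add_apply, extend_add, h, h', smul_add]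
  abel

lemma JacobiAt.smul_left {ε δ : ZMod 2} {a b c : R} (h : JacobiAt br ε δ a b c) (t : F) :
    JacobiAt br ε δ (t • a) b c := by
  unfold JacobiAt at *
  simp only [map_smul, LinearMap.smul_apply, extend_smul, h, smul_add]
  rw [smul_comm t (parSign F (ε * δ))]

lemma JacobiAt.add_middle {ε δ : ZMod 2} {a b b' c : R} (h : JacobiAt br ε δ a b c)
    (h' : JacobiAt br ε δ a b' c) : JacobiAt br ε δ a (b + b') c := by
  unfold JacobiAt at *
  rw [map_add, LinearMap.add_apply, map_add, h, h', map_add, map_add, extend_add, smul_add]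
  abel

lemma JacobiAt.smul_middle {ε δ : ZMod 2} {a b c : R} (h : JacobiAt br ε δ a b c) (t : F) :
    JacobiAt br ε δ a (t • b) c := by
  unfold JacobiAt at *
  rw [map_smul, LinearMap.smul_apply, map_smul, h, map_smul, map_smul, extend_smul, smul_add,
    smul_comm t (parSign F (ε * δ))]

lemma JacobiAt.add_right {ε δ : ZMod 2} {a b c c' : R} (h : JacobiAt br ε δ a b c)
    (h' : JacobiAt br ε δ a b c') : JacobiAt br ε δ a b (c + c') := by
  unfold JacobiAt at *
  rw [map_add, map_add, h, h', map_add, extend_add, map_add, map_add, smul_add]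
  abel

lemma JacobiAt.smul_right {ε δ : ZMod 2} {a b c : R} (h : JacobiAt br ε δ a b c) (t : F) :
    JacobiAt br ε δ a b (t • c) := by
  unfold JacobiAt at *
  rw [map_smul, map_smul, h, map_smul, extend_smul, map_smul, map_smul, smul_add,
    smul_comm t (parSign F (ε * δ))]

lemma JacobiAt.zero_left {ε δ : ZMod 2} {b c : R} : JacobiAt br ε δ 0 b c := by
  simp [JacobiAt, extend_zero]

lemma JacobiAt.zero_middle {ε δ : ZMod 2} {a c : R} : JacobiAt br ε δ a 0 c := by
  simp [JacobiAt, extend_zero]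

lemma JacobiAt.zero_right {ε δ : ZMod 2} {a b : R} : JacobiAt br ε δ a b 0 := by
  simp [JacobiAt, extend_zero]

/-- Each of the three terms is multiplied by -λ_i. In the last term λ_i must also pass b, and this
sign cancels the change of the prefactor. -/
lemma JacobiAt.X_smul_left
    (hl : ∀ (i : ι) (a b : R), br ((X i : SuperPoly F p) • a) b = -lamOp i (br a b))
    {ε δ : ZMod 2} {a b c : R} (h : JacobiAt br ε δ a b c) (i : ι) :
    JacobiAt br (p i + ε) δ ((X i : SuperPoly F p) • a) b c := by
  unfold JacobiAt at h ⊢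
  rw [extend_map_left (g := inr.comp (twist ε)) (T := br a)
      (fun η P => by simp only [AlgHom.comp_apply, twist_inr, twist_twist_comm η]) i
      (fun P => by simp only [AlgHom.comp_apply, ← twist_add, add_comm]) (inl_X_mul i)
      (fun c => hl i a c), h, hl, hl, map_neg, map_neg, extend_lamOp, extend_lamOp, AlgHom.comp_apply,
    twist_X, map_smul, inl_X, smul_add, smul_neg, neg_add, add_mul, parSign_add, mul_comm (p i) δ,
    smul_assoc, smul_smul, mul_right_comm, parSign_mul_self, one_mul, smul_comm (parSign F (ε * δ))]

/-- Up to one common sign each term is multiplied by -μ_i. For [[a_λ b]_{λ+μ} c] this factor arises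
as -(λ_i + μ_i) + λ_i, the two parts coming from ∂_i and λ_i in [a_λ (∂_i b)]. -/
lemma JacobiAt.X_smul_middle
    (hl : ∀ (i : ι) (a b : R), br ((X i : SuperPoly F p) • a) b = -lamOp i (br a b))
    {ε δ : ZMod 2} {a b c : R} (i : ι)
    (hr : ∀ c, br a ((X i : SuperPoly F p) • c) =
      parSign F (p i * ε) • (parOp i (br a c) + lamOp i (br a c)))
    (h : JacobiAt br ε δ a b c) :
    JacobiAt br ε (p i + δ) a ((X i : SuperPoly F p) • b) c := by
  unfold JacobiAt at h ⊢
  rw [extend_map_left (f := inr) (g := inl.comp (twist δ)) (T := br b)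
      (fun η P => by simp only [AlgHom.comp_apply, twist_inl, twist_twist_comm η]) i
      (fun P => by simp only [AlgHom.comp_apply, ← twist_add, add_comm]) (inr_X_mul i)
      (fun c => hl i b c), hr, hl, map_neg, extend_lamOp, map_smul, map_add, extend_lamOp,
    extend_parOp_left (fun η P => twist_inl η P) i (inAdd_X_mul i) (fun a => hl i a c), h,
    AlgHom.comp_apply, twist_X, map_smul, inl_X, inr_X, inAdd_X, mul_add, parSign_add,
    mul_comm ε (p i)]
  simp only [smul_add, smul_neg, add_smul, neg_add, smul_assoc, mul_smul,
    smul_comm (parSign F (ε * δ)) (X (Sum.inr i) : SuperPoly F (Sum.elim p p))]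
  abel

/-- Up to one common sign each term is acted on by ∂_i + λ_i + μ_i. In the middle term the sign
comes from the parity of [a_λ b], which is why that parity is a hypothesis. -/
lemma JacobiAt.X_smul_right {ε δ : ZMod 2} {a b c : R} (i : ι)
    (hr : ∀ ε a c, a ∈ gr ε → br a ((X i : SuperPoly F p) • c) =
      parSign F (p i * ε) • (parOp i (br a c) + lamOp i (br a c)))
    (ha : a ∈ gr ε) (hb : b ∈ gr δ) (hab : br a b ∈ tensorGr gr (ε + δ))
    (h : JacobiAt br ε δ a b c) :
    JacobiAt br ε δ a b ((X i : SuperPoly F p) • c) := by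
  have h1 : ∀ t, extend inl (inr.comp (twist ε)) (br a)
      (parSign F (p i * δ) • (parOp i t + lamOp i t)) =
      parSign F (p i * (ε + δ)) • totalOp i (extend inl (inr.comp (twist ε)) (br a) t) := by
    intro t
    rw [map_smul, map_add, extend_lamOp, extend_parOp_right (fun η P => twist_inl η P)
      (fun η P => by simp only [AlgHom.comp_apply, twist_inr, twist_twist_comm η]) i (inl_X_mul i)
      _ (fun c => hr ε a c ha), AlgHom.comp_apply, twist_X, map_smul, inl_X, inr_X, totalOp_apply,
      mul_add, parSign_add, mul_comm ε (p i), add_smul, smul_assoc, ← smul_add, smul_smul, add_assoc,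
      mul_comm (parSign F (p i * δ))]
  have h2 : ∀ t, extend inr (inl.comp (twist δ)) (br b)
      (parSign F (p i * ε) • (parOp i t + lamOp i t)) =
      parSign F (p i * (ε + δ)) • totalOp i (extend inr (inl.comp (twist δ)) (br b) t) := by
    intro t
    rw [map_smul, map_add, extend_lamOp, extend_parOp_right (fun η P => twist_inr η P)
      (fun η P => by simp only [AlgHom.comp_apply, twist_inl, twist_twist_comm η]) i (inr_X_mul i)
      _ (fun c => hr δ b c hb), AlgHom.comp_apply, twist_X, map_smul, inl_X, inr_X, totalOp_apply,
      mul_add, parSign_add, mul_comm δ (p i), add_smul, smul_assoc, ← smul_add, smul_smul, add_assoc,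
      add_comm (X (Sum.inr i) • _) ]
  have h3 := extend_map_right (f := inAdd) (g := inl) (T := br.flip c)
    (T' := br.flip ((X i : SuperPoly F p) • c)) (fun η P => twist_inAdd η P)
    (fun η P => twist_inl η P) i (inAdd_X_mul i) (fun δ a ha => hr δ a c ha) hab
  rw [inAdd_X, ← totalOp_apply] at h3
  unfold JacobiAt at h ⊢
  rw [hr δ b c hb, hr ε a c ha, h1, h2, h3, h, map_add, map_smul, smul_add,
    smul_comm (parSign F (ε * δ))]

/-- If `R` is spanned by homogeneous generators, bilinear skew-symmetry and the Jacobi identity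
follow from sesquilinearity and from the case of generators. -/
theorem IsLieConformalSuperalgebra.of_generators {κ : Type*} {e : κ → R} {q : κ → ZMod 2}
    (isCompl : IsCompl (gr 0) (gr 1))
    (smul_mem : ∀ (i : ι) (ε : ZMod 2) (a : R), a ∈ gr ε →
      (X i : SuperPoly F p) • a ∈ gr (p i + ε))
    (sesq_left : ∀ (i : ι) (a b : R), br ((X i : SuperPoly F p) • a) b = -lamOp i (br a b))
    (sesq_right : ∀ (i : ι) (ε : ZMod 2) (a b : R), a ∈ gr ε →
      br a ((X i : SuperPoly F p) • b) =
        parSign F (p i * ε) • (parOp i (br a b) + lamOp i (br a b)))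
    (gr_le : ∀ ε, gr ε ≤ homSpan (p := p) e q ε) (gen_mem : ∀ k, e k ∈ gr (q k))
    (bracket_mem : ∀ k l, br (e k) (e l) ∈ tensorGr gr (q k + q l))
    (skew : ∀ k l, br (e l) (e k) = -(parSign F (q k * q l) • substNeg (br (e k) (e l))))
    (jacobi : ∀ k l m, JacobiAt br (q k) (q l) (e k) (e l) (e m)) :
    IsLieConformalSuperalgebra gr br := by
  have bm : ∀ (ε δ : ZMod 2) (a b : R), a ∈ gr ε → b ∈ gr δ →
      br a b ∈ tensorGr gr (ε + δ) := by
    -- The right argument is extended first, with a generator on the left: the rule for ∂_i on the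
    -- right needs the parity of the left argument, while the rule on the left needs none. The same
    -- order is used for skew-symmetry.
    have bm' : ∀ (k : κ) (δ : ZMod 2) (b : R), b ∈ gr δ →
        br (e k) b ∈ tensorGr gr (q k + δ) := by
      intro k δ b hb
      refine homSpan_induction (C := fun δ b => br (e k) b ∈ tensorGr gr (q k + δ))
        (fun δ => by simp) (fun δ a b ha hb => by rw [map_add]; exact add_mem ha hb)
        (fun δ t b hb => by rw [map_smul]; exact Submodule.smul_mem _ t hb) (bracket_mem k) ?_
        (gr_le δ hb)
      intro i δ b hb
      rw [sesq_right i (q k) (e k) b (gen_mem k), add_left_comm]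
      exact Submodule.smul_mem _ _
        (add_mem (parOp_mem_tensorGr smul_mem i hb) (lamOp_mem_tensorGr i hb))
    intro ε δ a b ha hb
    refine homSpan_induction (C := fun ε a => br a b ∈ tensorGr gr (ε + δ))
      (fun ε => by simp)
      (fun ε a c ha hc => by rw [map_add]; exact add_mem ha hc)
      (fun ε t a ha => by rw [map_smul]; exact Submodule.smul_mem _ t ha)
      (fun k => bm' k δ b hb) ?_ (gr_le ε ha)
    intro i ε a ha
    rw [sesq_left, add_assoc]
    exact neg_mem (lamOp_mem_tensorGr i ha)
  refine ⟨isCompl, smul_mem, bm, sesq_left, sesq_right, ?_, ?_⟩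
  · have sk' : ∀ (k : κ) (δ : ZMod 2) (b : R), b ∈ gr δ →
        br b (e k) = -(parSign F (q k * δ) • substNeg (br (e k) b)) := by
      intro k δ b hb
      refine homSpan_induction
        (C := fun δ b => br b (e k) = -(parSign F (q k * δ) • substNeg (br (e k) b)))
        (fun δ => by simp)
        (fun δ a b ha hb => by
          rw [map_add, LinearMap.add_apply, ha, hb, map_add, map_add, smul_add, neg_add])
        (fun δ t b hb => by
          rw [map_smul, LinearMap.smul_apply, hb, map_smul, map_smul, smul_neg, smul_comm])
        (skew k) ?_ (gr_le δ hb)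
      intro i δ b hb
      rw [sesq_left, hb, sesq_right i (q k) (e k) b (gen_mem k), map_smul, map_add, substNeg_parOp,
        substNeg_lamOp, mul_add, parSign_add, mul_comm (q k) (p i), smul_smul, mul_right_comm,
        parSign_mul_self, one_mul, map_neg, map_smul]
      simp only [smul_add, smul_neg, neg_add, neg_neg]
      abel
    intro ε δ a b ha hb
    refine homSpan_induction (C := fun ε a => br b a = -(parSign F (ε * δ) • substNeg (br a b)))
      (fun ε => by simp)
      (fun ε a c ha hc => by
        rw [map_add, ha, hc, map_add, LinearMap.add_apply, map_add, smul_add, neg_add])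
      (fun ε t a ha => by
        rw [map_smul, ha, map_smul, LinearMap.smul_apply, map_smul, smul_neg, smul_comm])
      (fun k => sk' k δ b hb) ?_ (gr_le ε ha)
    intro i ε a ha
    rw [sesq_right i δ b a hb, ha, sesq_left]
    simp only [map_neg, map_smul, substNeg_lamOp, add_mul, parSign_add, mul_smul, neg_neg, smul_add,
      smul_neg, neg_add]
  · have j1 : ∀ k l c, JacobiAt br (q k) (q l) (e k) (e l) c := by
      intro k l c
      -- The Jacobi identity puts no parity condition on c, whereas the induction runs over
      -- homogeneous elements.
      obtain ⟨c0, h0, c1, h1, rfl⟩ := Submodule.mem_sup.mp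
        (isCompl.sup_eq_top ▸ Submodule.mem_top : c ∈ gr 0 ⊔ gr 1)
      have h : ∀ ε, ∀ c ∈ gr ε, JacobiAt br (q k) (q l) (e k) (e l) c := by
        intro ε c hc
        exact homSpan_induction (C := fun _ c => JacobiAt br (q k) (q l) (e k) (e l) c)
          (fun _ => JacobiAt.zero_right) (fun _ _ _ => JacobiAt.add_right)
          (fun _ t _ h => h.smul_right t) (jacobi k l)
          (fun i _ _ h => h.X_smul_right i (fun ε a c ha => sesq_right i ε a c ha) (gen_mem k)
            (gen_mem l) (bracket_mem k l)) (gr_le ε hc)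
      exact (h 0 c0 h0).add_right (h 1 c1 h1)
    have j2 : ∀ k δ b c, b ∈ gr δ → JacobiAt br (q k) δ (e k) b c := by
      intro k δ b c hb
      exact homSpan_induction (C := fun δ b => JacobiAt br (q k) δ (e k) b c)
        (fun _ => JacobiAt.zero_middle) (fun _ _ _ => JacobiAt.add_middle)
        (fun _ t _ h => h.smul_middle t) (fun l => j1 k l c)
        (fun i _ _ h => h.X_smul_middle sesq_left i
          (fun c => sesq_right i (q k) (e k) c (gen_mem k))) (gr_le δ hb)
    intro ε δ a b c ha hb
    exact homSpan_induction (C := fun ε a => JacobiAt br ε δ a b c)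
      (fun _ => JacobiAt.zero_left) (fun _ _ _ => JacobiAt.add_left)
      (fun _ t _ h => h.smul_left t) (fun k => j2 k δ b c hb)
      (fun i _ _ h => h.X_smul_left sesq_left i) (gr_le ε ha)

end Generators

end

end LieConformal

/-! ### RW(r, s) is a Lie conformal superalgebra -/

namespace LieConformal

open SuperPoly

noncomputable section

section RW

variable (F : Type*) [Field F] (r s : ℕ)

lemma rwBr_apply (x y : RW F r s) : rwBr F r s x y = ∑ i, ∑ j, neg (x i) •
    shift (1 : F) (twist (typeParity r s i) (y j)) (rwGenBr F r s i j) := rfl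

lemma rwBr_X_smul_left (i : Fin r ⊕ Fin s) (a b : RW F r s) :
    rwBr F r s ((X i : Poly F r s) • a) b = -lamOp i (rwBr F r s a b) := by
  simp only [rwBr_apply, map_sum, ← Finset.sum_neg_distrib, lamOp_eq_smul]
  refine Finset.sum_congr rfl fun k _ => Finset.sum_congr rfl fun l _ => ?_
  rw [Pi.smul_apply, smul_eq_mul, map_mul, neg_X, mul_smul, neg_smul]

lemma neg_mem_homog {ι : Type*} {p : ι → ZMod 2} {ε : ZMod 2} {P : SuperPoly F p}
    (hP : P ∈ homog F p ε) : neg P ∈ homog F p ε := by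
  induction hP using Submodule.span_induction with
  | mem P h =>
    obtain ⟨K, rfl, rfl⟩ := h
    induction K with
    | nil => simpa using one_mem_homog
    | cons i K ih =>
      simp only [List.map_cons, List.prod_cons, List.sum_cons, map_mul, neg_X, neg_mul]
      exact neg_mem (X_mul_mem_homog i ih)
  | zero => simp
  | add P Q _ _ hP hQ => rw [map_add]; exact add_mem hP hQ
  | smul t P _ hP => rw [map_smul]; exact Submodule.smul_mem _ t hP

lemma add_self_zmod_two (a : ZMod 2) : a + a = 0 := CharTwo.add_self_eq_zero a

/-- If a has parity ε, its k-th coordinate has parity ε + p_k. The operator λ_i + ∂_i passes that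
coordinate, and the twist by p_k in the definition of the bracket removes the contribution of p_k,
leaving the sign of p_i ε. -/
lemma rwBr_X_smul_right (i : Fin r ⊕ Fin s) (ε : ZMod 2) (a b : RW F r s)
    (ha : a ∈ rwGr F r s ε) : rwBr F r s a ((X i : Poly F r s) • b) =
      parSign F (typeParity r s i * ε) •
        (parOp i (rwBr F r s a b) + lamOp i (rwBr F r s a b)) := by
  simp only [rwBr_apply, map_sum, ← Finset.sum_add_distrib, Finset.smul_sum]
  refine Finset.sum_congr rfl fun k _ => Finset.sum_congr rfl fun l _ => ?_
  have hk := neg_mem_homog F (ha k trivial)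
  rw [Pi.smul_apply, smul_eq_mul, map_mul, map_mul, twist_X, map_smul, shift_X, one_smul,
    parOp_smul, lamOp_smul, twist_of_mem_homog hk, ← smul_add, smul_assoc, smul_smul,
    Module.End.mul_apply, LinearMap.smul_apply, LinearMap.add_apply, smul_comm, mul_add, parSign_add,
    ← mul_assoc, parSign_mul_self, one_mul, mul_comm (typeParity r s k), add_comm (lamOp i _)]

lemma rwGen_mem (i : Fin r ⊕ Fin s) : rwGen F r s i ∈ rwGr F r s (typeParity r s i) := by
  intro k _
  by_cases h : k = i
  · subst h
    change rwGen F r s k k ∈ homog F _ (typeParity r s k + typeParity r s k)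
    rw [rwGen, Pi.single_eq_same, add_self_zmod_two]
    exact one_mem_homog
  · rw [rwGen, Pi.single_eq_of_ne h]
    exact zero_mem _

lemma smul_mem_rwGr (i : Fin r ⊕ Fin s) (ε : ZMod 2) (a : RW F r s) (ha : a ∈ rwGr F r s ε) :
    (X i : Poly F r s) • a ∈ rwGr F r s (typeParity r s i + ε) := by
  intro k _
  change X i * a k ∈ homog F _ (typeParity r s i + ε + typeParity r s k)
  rw [add_assoc]
  exact X_mul_mem_homog i (ha k trivial)

lemma homog_smul_mem_homSpan {ι : Type*} {p : ι → ZMod 2} {R : Type*} [AddCommGroup R] [Module F R]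
    [Module (SuperPoly F p) R] [IsScalarTower F (SuperPoly F p) R] {κ : Type*} {e : κ → R}
    {q : κ → ZMod 2} {γ : ZMod 2} {P : SuperPoly F p} (hP : P ∈ homog F p γ) (k : κ) :
    P • e k ∈ homSpan (F := F) (p := p) e q (γ + q k) := by
  induction hP using Submodule.span_induction with
  | mem P h =>
    obtain ⟨K, rfl, rfl⟩ := h
    exact Submodule.subset_span ⟨K, k, rfl, rfl⟩
  | zero => rw [zero_smul]; exact zero_mem _
  | add P Q _ _ hP hQ => rw [add_smul]; exact add_mem hP hQ
  | smul t P _ hP => rw [smul_assoc]; exact Submodule.smul_mem _ t hP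

lemma sum_smul_rwGen (a : RW F r s) : ∑ k, a k • rwGen F r s k = a := by
  ext k
  simp [rwGen, Pi.single_apply]

lemma rwGr_le_homSpan (ε : ZMod 2) :
    rwGr F r s ε ≤ homSpan (p := typeParity r s) (rwGen F r s) (typeParity r s) ε := by
  intro a ha
  rw [← sum_smul_rwGen F r s a]
  refine Submodule.sum_mem _ fun k _ => ?_
  have h := homog_smul_mem_homSpan F (e := rwGen F r s) (q := typeParity r s) (ha k trivial) k
  rwa [add_assoc, add_self_zmod_two, add_zero] at h

lemma isCompl_rwGr [CharZero F] : IsCompl (rwGr F r s 0) (rwGr F r s 1) := by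
  -- At a coordinate whose generator is odd, the two parities are exchanged.
  have hc : ∀ δ : ZMod 2, IsCompl (homog F (typeParity r s) (0 + δ))
      (homog F (typeParity r s) (1 + δ)) := by
    intro δ
    rcases zmod_two_cases δ with rfl | rfl
    · exact isCompl_homog
    · exact isCompl_homog.symm
  constructor
  · rw [Submodule.disjoint_def]
    intro a h0 h1
    funext k
    exact Submodule.disjoint_def.mp (hc _).disjoint _ (h0 k trivial) (h1 k trivial)
  · rw [codisjoint_iff, eq_top_iff]
    intro a _
    have h : ∀ k, ∃ b ∈ homog F (typeParity r s) (0 + typeParity r s k),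
        ∃ c ∈ homog F (typeParity r s) (1 + typeParity r s k), b + c = a k := fun k =>
      Submodule.mem_sup.mp ((hc _).sup_eq_top ▸ Submodule.mem_top)
    choose b hb c hc' hbc using h
    exact Submodule.mem_sup.mpr ⟨b, fun k _ => hb k, c, fun k _ => hc' k, funext hbc⟩

lemma rwGenBr_mem (i j : Fin r ⊕ Fin s) :
    rwGenBr F r s i j ∈ tensorGr (rwGr F r s) (typeParity r s i + typeParity r s j) := by
  refine add_mem (add_mem ?_ ?_) (Submodule.smul_mem _ _ ?_)
  · exact Submodule.subset_span ⟨0, _, zero_add _, _, one_mem_homog, _,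
      smul_mem_rwGr F r s i _ _ (rwGen_mem F r s j), rfl⟩
  · exact Submodule.subset_span ⟨_, _, rfl, _, X_mem_homog i, _, rwGen_mem F r s j, rfl⟩
  · exact Submodule.subset_span ⟨_, _, add_comm _ _, _, X_mem_homog j, _, rwGen_mem F r s i, rfl⟩

lemma rwGenBr_skew (i j : Fin r ⊕ Fin s) : rwGenBr F r s j i =
    -(parSign F (typeParity r s i * typeParity r s j) • substNeg (rwGenBr F r s i j)) := by
  have h1 : ∀ c : RW F r s, substNeg ((1 : Poly F r s) ⊗ₜ[F] c) = 1 ⊗ₜ c := fun c => by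
    rw [substNeg_tmul, map_one, Module.End.one_apply]
  have h2 : ∀ i, ∀ c : RW F r s, substNeg ((X i : Poly F r s) ⊗ₜ[F] c) =
      -(1 ⊗ₜ ((X i : Poly F r s) • c) + X i ⊗ₜ c) := fun i c => by
    have h := substNeg_lamOp i ((1 : Poly F r s) ⊗ₜ[F] c)
    rwa [h1, lamOp_tmul, parOp_tmul, map_one, mul_one] at h
  rw [rwGenBr, rwGenBr, map_add, map_add, map_smul, h1, h2, h2, mul_comm (typeParity r s j)]
  simp only [smul_add, smul_neg, smul_smul, parSign_mul_self, one_smul]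
  abel

lemma rTensor_rwGenBr (f : Poly F r s →ₐ[F] SuperPoly F (Sum.elim (typeParity r s) (typeParity r s)))
    (i j : Fin r ⊕ Fin s) : LinearMap.rTensor (RW F r s) f.toLinearMap (rwGenBr F r s i j) =
      parOp₂ i (1 ⊗ₜ rwGen F r s j) + f (X i) • (1 ⊗ₜ rwGen F r s j) +
        parSign F (typeParity r s i * typeParity r s j) • f (X j) • (1 ⊗ₜ rwGen F r s i) := by
  simp [rwGenBr, TensorProduct.smul_tmul']

lemma parSign_eq_or (ε : ZMod 2) : parSign F ε = 1 ∨ parSign F ε = -1 := by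
  rcases zmod_two_cases ε with rfl | rfl
  · exact Or.inl (parSign_zero F)
  · exact Or.inr (parSign_one F)

/-- The Jacobi identity for a_i, a_j, a_k after normal ordering: s₁, s₂, s₃ are the signs of p_i
p_j, p_i p_k, p_j p_k, and the x's are the words that occur. For fixed signs it is an identity in an
abelian group. -/
lemma jacobi_signs {M : Type*} [AddCommGroup M] [Module F M] {s₁ s₂ s₃ : F}
    (h₁ : s₁ = 1 ∨ s₁ = -1) (h₂ : s₂ = 1 ∨ s₂ = -1) (h₃ : s₃ = 1 ∨ s₃ = -1)
    (x1 x2 x3 x4 x5 x6 x7 x8 x9 x10 x11 x12 x13 x14 x15 x16 x17 x18 x19 : M) :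
    s₁ • x1 + s₁ • s₁ • x2 + s₁ • s₂ • s₃ • x3 + (s₁ • x4 + s₁ • x5 + s₁ • s₂ • x6) +
        (s₁ • x7 + s₁ • s₁ • x8 + s₂ • s₁ • s₃ • x9) +
      (s₃ • s₂ • x10 + s₃ • s₂ • s₂ • x11 + s₃ • s₁ • s₂ • s₃ • x12) =
    -(x2 + x13 + (x14 + s₁ • x15 + (x8 + x16)) + (s₃ • x17 + s₃ • s₂ • x18 + (s₃ • x11 + s₃ • x19))) +
          (x2 + (x14 + x8) + (s₃ • x17 + s₃ • x11)) +
        (s₁ • x4 + (s₁ • x5 + s₁ • x15) + (s₁ • s₂ • x6 + s₁ • s₂ • x12)) +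
      (s₁ • s₁ • s₁ • x1 + s₁ • s₁ • s₁ • x7 + s₁ • s₁ • s₃ • s₂ • x10 +
            (s₁ • s₁ • x13 + s₁ • s₁ • x16 + s₁ • s₁ • s₃ • x19) +
          (s₁ • s₁ • x2 + s₁ • s₁ • x8 + s₁ • s₃ • s₁ • x11) +
        (s₁ • s₂ • s₃ • x3 + s₁ • s₂ • s₃ • x9 + s₁ • s₂ • s₁ • s₃ • x18)) := by
  rcases h₁ with rfl | rfl <;> rcases h₂ with rfl | rfl <;> rcases h₃ with rfl | rfl <;>
    (simp only [one_smul, neg_smul, smul_neg, neg_neg]; abel)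

lemma rwGen_jacobi (i j k : Fin r ⊕ Fin s) :
    JacobiAt (rwBr F r s) (typeParity r s i) (typeParity r s j) (rwGen F r s i) (rwGen F r s j)
      (rwGen F r s k) := by
  set p := typeParity r s with hp
  let m : Fin r ⊕ Fin s → SuperPoly F (Sum.elim p p) ⊗[F] RW F r s := fun k => 1 ⊗ₜ rwGen F r s k
  -- These rules bring every word to the order λ, μ, ∂ with its sign in front, so that equal terms
  -- become syntactically equal.
  have hX : ∀ a b n, (X (Sum.inr a) : SuperPoly F (Sum.elim p p)) • (X (Sum.inl b) :
      SuperPoly F (Sum.elim p p)) • m n = parSign F (p a * p b) •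
        (X (Sum.inl b) : SuperPoly F (Sum.elim p p)) • (X (Sum.inr a) :
          SuperPoly F (Sum.elim p p)) • m n := by
    intro a b n
    rw [smul_smul, X_mul_X, smul_assoc, mul_smul]
    rfl
  have hl : ∀ a b n, parOp₂ a ((X (Sum.inl b) : SuperPoly F (Sum.elim p p)) • m n) =
      parSign F (p a * p b) • (X (Sum.inl b) : SuperPoly F (Sum.elim p p)) • parOp₂ a (m n) := by
    intro a b n
    rw [parOp₂_smul, twist_X, smul_assoc]
    rfl
  have hr : ∀ a b n, parOp₂ a ((X (Sum.inr b) : SuperPoly F (Sum.elim p p)) • m n) =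
      parSign F (p a * p b) • (X (Sum.inr b) : SuperPoly F (Sum.elim p p)) • parOp₂ a (m n) := by
    intro a b n
    rw [parOp₂_smul, twist_X, smul_assoc]
    rfl
  have hd : parOp₂ i (parOp₂ j (m k)) = parSign F (p i * p j) • parOp₂ j (parOp₂ i (m k)) := by
    change twist (p i) (twist (p j) 1) ⊗ₜ ((X i : Poly F r s) • (X j : Poly F r s) • rwGen F r s k) =
      parSign F (p i * p j) • (twist (p j) (twist (p i) 1) ⊗ₜ
        ((X j : Poly F r s) • (X i : Poly F r s) • rwGen F r s k))
    rw [smul_smul, X_mul_X, smul_assoc, mul_smul, TensorProduct.tmul_smul]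
    simp only [map_one]
    rfl
  have hbr : ∀ a b, ∀ f : Poly F r s →ₐ[F] SuperPoly F (Sum.elim p p),
      LinearMap.rTensor (RW F r s) f.toLinearMap
        (rwBr F r s (rwGen F r s a) (rwGen F r s b)) = parOp₂ a (m b) + f (X a) • m b +
          parSign F (p a * p b) • f (X b) • m a := fun a b f => by
    rw [rwBr_gen]
    exact rTensor_rwGenBr F r s f a b
  have hbr' : ∀ a b c, ∀ f : Poly F r s →ₐ[F] SuperPoly F (Sum.elim p p),
      (∀ ε P, twist ε (f P) = f (twist ε P)) →
      LinearMap.rTensor (RW F r s) f.toLinearMap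
        (rwBr F r s (rwGen F r s a) ((X b : Poly F r s) • rwGen F r s c)) =
        parSign F (p b * p a) •
          (parOp₂ b (parOp₂ a (m c) + f (X a) • m c + parSign F (p a * p c) • f (X c) • m a) +
          f (X b) • (parOp₂ a (m c) + f (X a) • m c + parSign F (p a * p c) • f (X c) • m a)) :=
    fun a b c f hf => by
      rw [rwBr_X_smul_right F r s b _ _ _ (rwGen_mem F r s a), map_smul, map_add, rTensor_parOp f hf,
        lamOp_eq_smul, rTensor_smul, hbr]
  have hbr'' : LinearMap.rTensor (RW F r s) (inAdd (p := p)).toLinearMap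
        (rwBr F r s ((X i : Poly F r s) • rwGen F r s j) (rwGen F r s k)) =
        -(inAdd (X i : Poly F r s) • (parOp₂ j (m k) + inAdd (X j : Poly F r s) • m k +
          parSign F (p j * p k) • inAdd (X k : Poly F r s) • m j)) := by
    rw [rwBr_X_smul_left, map_neg, lamOp_eq_smul, rTensor_smul, hbr]
  have hs : ∀ (Q : SuperPoly F (Sum.elim p p)) (t : F)
      (x : SuperPoly F (Sum.elim p p) ⊗[F] RW F r s), Q • t • x = t • Q • x :=
    fun Q t x => smul_comm Q t x
  unfold JacobiAt
  rw [rwBr_gen, rwBr_gen, rwBr_gen, rwGenBr, rwGenBr, rwGenBr]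
  simp only [map_add, map_smul, extend_tmul, map_one, one_smul, LinearMap.flip_apply,
    hbr, hbr' _ _ _ inl (fun ε P => twist_inl ε P), hbr' _ _ _ inr (fun ε P => twist_inr ε P), hbr'',
    AlgHom.comp_apply, twist_X, inl_X, inr_X, inAdd_X]
  simp only [← hp, smul_add, add_smul, smul_assoc, hs, hX, hl, hr, hd,
    mul_comm (p j) (p i), mul_comm (p k) (p i), mul_comm (p k) (p j)]
  exact jacobi_signs F (parSign_eq_or F _) (parSign_eq_or F _) (parSign_eq_or F _)
    _ _ _ _ _ _ _ _ _ _ _ _ _ _ _ _ _ _ _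

theorem isLieConformalSuperalgebra_rw [CharZero F] :
    IsLieConformalSuperalgebra (rwGr F r s) (rwBr F r s) :=
  .of_generators (isCompl_rwGr F r s) (smul_mem_rwGr F r s) (rwBr_X_smul_left F r s)
    (rwBr_X_smul_right F r s) (rwGr_le_homSpan F r s) (rwGen_mem F r s)
    (fun k l => by rw [rwBr_gen]; exact rwGenBr_mem F r s k l)
    (fun k l => by rw [rwBr_gen, rwBr_gen]; exact rwGenBr_skew F r s k l)
    (rwGen_jacobi F r s)

end RW

end

end LieConformal

/-! ### The bracket formula for one coefficient -/

section Map

variable {A B : Type*} [Ring A] [Ring B]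

lemma map_mulB (f : A →+* B) (u v : Fin 4 ⊕ Fin 4 → A) (r : A) :
    f (mulB u v r) = mulB (f ∘ u) (f ∘ v) (f r) := by
  simp only [mulB, map_add, map_mul, Function.comp_apply]

lemma map_cubicOf (f : A →+* B) (u : Fin 4 ⊕ Fin 4 → A) (i : Fin 4 ⊕ Fin 4) :
    f (cubicOf u i) = cubicOf (f ∘ u) i := by
  rcases i with i | i
  · fin_cases i <;> simp [cubicOf]
  · simp [cubicOf]

lemma map_cubicDual (f : A →+* B) (u : Fin 4 ⊕ Fin 4 → A) (i : Fin 4 ⊕ Fin 4) :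
    f (cubicDual u i) = cubicDual (f ∘ u) i := by
  rcases i with i | i
  · exact map_zero f
  · exact map_cubicOf f u (.inl i)

lemma map_mulPhi (f : A →+* B) (u : Fin 4 ⊕ Fin 4 → A) (i : Fin 4 ⊕ Fin 4) (r : A) :
    f (mulPhi u i r) = mulPhi (f ∘ u) i (f r) := by
  simp only [mulPhi, map_add, map_mul, map_neg, map_mulB, map_cubicOf, Function.comp_apply]

lemma map_alphaCoeff (f : A →+* B) (u : Fin 4 ⊕ Fin 4 → A) (i k : Fin 4 ⊕ Fin 4) :
    f (alphaCoeff u i k) = alphaCoeff (f ∘ u) i k := by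
  simp only [alphaCoeff, map_add, map_mul, map_mulPhi, map_cubicDual, Function.comp_apply]

lemma cubicOf_neg (u : Fin 4 ⊕ Fin 4 → A) (i : Fin 4 ⊕ Fin 4) : cubicOf (-u) i = -cubicOf u i := by
  rcases i with i | i
  · fin_cases i <;> simp [cubicOf]
  · simp [cubicOf]

lemma cubicDual_neg (u : Fin 4 ⊕ Fin 4 → A) (i : Fin 4 ⊕ Fin 4) :
    cubicDual (-u) i = -cubicDual u i := by
  rcases i with i | i
  · exact neg_zero.symm
  · exact cubicOf_neg u (.inl i)

/-- The coefficient is homogeneous of degree four. Therefore the substitution of -λ for ∂ in the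
left argument of the bracket leaves no sign. -/
lemma alphaCoeff_neg (u : Fin 4 ⊕ Fin 4 → A) (i k : Fin 4 ⊕ Fin 4) :
    alphaCoeff (-u) i k = alphaCoeff u i k := by
  simp only [alphaCoeff, mulPhi, mulB, cubicOf_neg, cubicDual_neg, Pi.neg_apply]
  noncomm_ring

lemma mulPhi_add (u : Fin 4 ⊕ Fin 4 → A) (i : Fin 4 ⊕ Fin 4) (r s : A) :
    mulPhi u i (r + s) = mulPhi u i r + mulPhi u i s := by
  simp only [mulPhi, mulB, mul_add, neg_add]
  abel

lemma mulPhi_neg (u : Fin 4 ⊕ Fin 4 → A) (i : Fin 4 ⊕ Fin 4) (r : A) :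
    mulPhi u i (-r) = -mulPhi u i r := by
  simp only [mulPhi, mulB, mul_neg, mul_add, neg_add]

lemma mulPhi_mul (u : Fin 4 ⊕ Fin 4 → A) (i : Fin 4 ⊕ Fin 4) (r s : A) :
    mulPhi u i (r * s) = mulPhi u i r * s := by
  simp only [mulPhi, mulB, add_mul, mul_add, neg_mul, mul_assoc]

lemma mulPhi_signIf (u : Fin 4 ⊕ Fin 4 → A) (i : Fin 4 ⊕ Fin 4) (s : Bool) (r : A) :
    mulPhi u i (signIf s r) = signIf s (mulPhi u i r) := by
  cases s
  · rfl
  · exact mulPhi_neg u i r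

lemma mul_signIf (s : Bool) (a r : A) : a * signIf s r = signIf s (a * r) := by
  cases s
  · rfl
  · exact mul_neg a r

lemma signIf_add (s : Bool) (a r : A) : signIf s (a + r) = signIf s a + signIf s r := by
  cases s
  · rfl
  · exact neg_add a r

lemma mulB_mul (u v : Fin 4 ⊕ Fin 4 → A) (r s : A) : mulB u v (r * s) = mulB u v r * s := by
  simp only [mulB, add_mul, mul_assoc]

lemma cubicDual_sum (u v : Fin 4 ⊕ Fin 4 → A) (r : A) :
    mulB (cubicOf u) v r = ∑ n, cubicDual u n * (v n * r) := by
  rw [mulB_eq_sum, Fintype.sum_sum_type]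
  simp [cubicDual]

/-- This connects the factored form used in the computation, where φ_i stands in front of C_{uv},
with the sum over coefficients produced by the bracket. -/
lemma mulAlpha_eq_sum (u v : Fin 4 ⊕ Fin 4 → A) (i : Fin 4 ⊕ Fin 4) (r : A) :
    mulAlpha u v i r = ∑ n, alphaCoeff u i n * (v n * r) := by
  have h : mulPhi u i (mulC u v r) = ∑ n, mulPhi u i (u n.swap) * (v n * r) := by
    rw [mulC_eq_sum]
    have hs : mulPhi u i (∑ n, u n * (v n.swap * r)) = ∑ n, mulPhi u i (u n * (v n.swap * r)) :=
      map_sum (AddMonoidHom.mk' (mulPhi u i) (mulPhi_add u i)) _ _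
    rw [hs, ← Equiv.sum_comp (Equiv.sumComm (Fin 4) (Fin 4))]
    refine Finset.sum_congr rfl fun n _ => ?_
    simp only [Equiv.sumComm_apply, Sum.swap_swap, mulPhi_mul]
  simp only [mulAlpha, h, cubicDual_sum, Finset.mul_sum, alphaCoeff, add_mul,
    Finset.sum_add_distrib, mul_assoc]

/-- The formula for `[α_i_λ α_j]`, for the coefficient of a generator and with all operators on
the left. -/
theorem alpha_bracket_coeff {y : Bool → Fin 4 ⊕ Fin 4 → A} (hy : IsSuperPair y)
    (i j k : Fin 4 ⊕ Fin 4) {l d w : Fin 4 ⊕ Fin 4 → A} (hl : y false = l) (hd : y true = d)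
    (hw : l + d = w) :
    mulAlpha l w i (alphaCoeff w j k) +
        signIf (j.isRight && k.isRight) (alphaCoeff l i k * mulAlpha w l j 1) =
      signIf j.isRight (mulPhi l i (l j)) * alphaSum l d k -
        2 * (l i * cubicOf l j) * alphaSum l d k + 3 * (l i * l j) * alphaSum (cubicOf l) d k +
        mulAlpha l d i (alphaCoeff d j k) := by
  have h := bracketDiff_eq_zero hy i j k
  have hs : ∀ x : A, signIf j.isRight (mulPhi l i (l j)) * x =
      signIf j.isRight (mulPhi l i (l j * x)) := fun x => by
    rw [mulPhi_mul]
    cases j.isRight <;> simp [signIf]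
  rw [bracketDiff, hl, hd, hw] at h
  simp only [bracketY, bracketZ, mulPhi_add, mulPhi_neg, mulPhi_signIf, mul_add, mul_neg,
    mul_signIf] at h
  -- Splitting the outer α_i into its φ_i part and its λ_i part turns the difference of the two
  -- sides into φ_i Y + λ_i Z.
  rw [hs, ← sub_eq_zero, ← h, mulAlpha.eq_def l w, mulAlpha.eq_def l d, alphaCoeff.eq_def l i k, add_mul, signIf_add,
    mulPhi_mul l i (l k.swap), mul_assoc (l i) (cubicDual l k)]
  noncomm_ring

end Map

/-! ### Coefficients of the α_i and their parities -/

namespace SuperPoly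

variable {F : Type*} [Field F] {ι : Type*} {p : ι → ZMod 2}

lemma mul_mem_homog {γ δ ε : ZMod 2} {P Q : SuperPoly F p} (hP : P ∈ homog F p γ)
    (hQ : Q ∈ homog F p δ) (h : γ + δ = ε) : P * Q ∈ homog F p ε := by
  subst h
  induction hP using Submodule.span_induction with
  | mem P h =>
    obtain ⟨K, rfl, rfl⟩ := h
    induction K with
    | nil => simpa using hQ
    | cons a K ih => simpa [mul_assoc, add_assoc] using X_mul_mem_homog a ih
  | zero => simp
  | add P P' _ _ h h' => rw [add_mul]; exact add_mem h h'
  | smul t P _ h => rw [smul_mul_assoc]; exact Submodule.smul_mem _ t h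

lemma X_mul_of_mem_homog (i : ι) {γ : ZMod 2} {P : SuperPoly F p} (hP : P ∈ homog F p γ) :
    X i * P = parSign F (p i * γ) • (P * X i) := by
  rw [X_mul_eq, twist_of_mem_homog hP, smul_mul_assoc]

end SuperPoly

namespace LieConformal

open SuperPoly

noncomputable section

section AlphaBracket

variable (F : Type*) [Field F]

lemma cubic_eq_cubicOf : cubic F = cubicOf (X : Fin 4 ⊕ Fin 4 → Poly F 4 4) := by
  funext i
  rcases i with i | i
  · fin_cases i <;> simp [cubic, cubicOf, mul_assoc]
  · rfl

lemma pairB_mul {A : Type*} [Ring A] (u v : Fin 4 ⊕ Fin 4 → A) :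
    pairB (· * ·) u v = mulB u v 1 := by
  simp [pairB, mulB_eq_sum]

lemma pairC_eq_sum {U V W : Type*} [AddCommMonoid W] (m : U → V → W) (u : Fin 4 ⊕ Fin 4 → U)
    (v : Fin 4 ⊕ Fin 4 → V) : pairC m u v = ∑ n, m (u n) (v n.swap) := by
  rw [pairC, Finset.sum_add_distrib, Fintype.sum_sum_type]
  simp

lemma pairB_cubic_eq_sum {U V W : Type*} [Zero U] [AddCommMonoid W] (m : U → V → W)
    (hm : ∀ v, m 0 v = 0) (u : Fin 4 ⊕ Fin 4 → U) (hu : ∀ k, u (.inr k) = 0)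
    (v : Fin 4 ⊕ Fin 4 → V) : pairB m u v = ∑ n, m (u n) (v n.swap) := by
  rw [pairB, Fintype.sum_sum_type]
  simp [hu, hm]

lemma alpha_apply (i k : Fin 4 ⊕ Fin 4) :
    alpha F i k = alphaCoeff (X : Fin 4 ⊕ Fin 4 → Poly F 4 4) i k := by
  have hC : pairC (· • ·) (X : _ → Poly F 4 4) (rwGen F 4 4) k = X k.swap := by
    rw [pairC_eq_sum, Finset.sum_apply, Finset.sum_eq_single k.swap]
    · simp [rwGen]
    · intro n _ hn
      have : k ≠ n.swap := fun h => hn (by rw [h, Sum.swap_swap])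
      simp [rwGen, Pi.single_eq_of_ne this]
    · simp
  have hB : pairB (· • ·) (cubicOf (X : _ → Poly F 4 4)) (rwGen F 4 4) k = cubicDual X k := by
    rw [pairB, Finset.sum_apply]
    rcases k with k | k
    · simp [rwGen, cubicDual]
    · rw [Finset.sum_eq_single k]
      · simp [rwGen, cubicDual]
      · intro n _ hn
        simp [rwGen, hn.symm]
      · simp
  rw [alpha, cubic_eq_cubicOf, pairB_mul]
  simp only [Pi.add_apply, Pi.sub_apply, Pi.smul_apply, hC, hB, smul_eq_mul]
  rw [alphaCoeff, mulPhi, ← one_mul (X k.swap : Poly F 4 4), mulB_mul]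
  noncomm_ring

lemma parSign_typeParity_smul {A : Type*} [Ring A] [Algebra F A] (i j : Fin 4 ⊕ Fin 4) (a : A) :
    parSign F (typeParity 4 4 i * typeParity 4 4 j) • a = signIf (i.isRight && j.isRight) a := by
  rcases i with i | i <;> rcases j with j | j <;> simp [typeParity, signIf]

lemma cubic_mem_homog (i : Fin 4 ⊕ Fin 4) : cubic F i ∈ homog F (typeParity 4 4) 1 := by
  have hX : ∀ a : Fin 4, (X (.inr a) : Poly F 4 4) ∈ homog F (typeParity 4 4) 1 :=
    fun a => X_mem_homog (F := F) (p := typeParity 4 4) (Sum.inr a)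
  have h : ∀ a b c : Fin 4, (X (.inr a) * (X (.inr b) * X (.inr c)) : Poly F 4 4) ∈
      homog F (typeParity 4 4) 1 := fun a b c =>
    mul_mem_homog (hX a) (mul_mem_homog (hX b) (hX c) rfl) rfl
  rw [cubic_eq_cubicOf]
  rcases i with i | i
  · fin_cases i
    · exact h 1 2 3
    · exact (homog F (typeParity 4 4) 1).neg_mem (h 0 2 3)
    · exact h 0 1 3
    · exact (homog F (typeParity 4 4) 1).neg_mem (h 0 1 2)
  · exact (homog F (typeParity 4 4) 1).zero_mem

lemma mulB_X_mem_homog : mulB (X : _ → Poly F 4 4) X 1 ∈ homog F (typeParity 4 4) 1 := by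
  rw [mulB_eq_sum]
  refine Submodule.sum_mem _ fun k _ => ?_
  rw [mul_one]
  exact mul_mem_homog (X_mem_homog (F := F) (p := typeParity 4 4) (Sum.inl k))
    (X_mem_homog (Sum.inr k)) rfl

lemma X_mul_of_mem_homog_one (j : Fin 4 ⊕ Fin 4) {P : Poly F 4 4}
    (hP : P ∈ homog F (typeParity 4 4) 1) : X j * P = signIf j.isRight (P * X j) := by
  rw [X_mul_of_mem_homog j hP]
  have h := parSign_typeParity_smul F j (.inr 0) (P * X j)
  rwa [Sum.isRight_inr, Bool.and_true] at h

/-- B_{λλ} and μ_i are both odd, so moving λ_j to their right costs the same sign. The first and the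
third term then combine to φ_i λ_j. -/
lemma first_coeff_eq (i j : Fin 4 ⊕ Fin 4) :
    (X i * X j * pairB (· * ·) X X - 2 * X i * cubic F j - 2 * X j * cubic F i : Poly F 4 4) =
      signIf j.isRight (mulPhi X i (X j)) - 2 * (X i * cubicOf X j) := by
  have h1 := X_mul_of_mem_homog_one F j (cubic_mem_homog F i)
  have h2 := X_mul_of_mem_homog_one F j (mulB_X_mem_homog F)
  rw [pairB_mul, mul_assoc (X i), h2, mul_assoc 2 (X j), h1, cubic_eq_cubicOf, mulPhi,
    ← one_mul (X j : Poly F 4 4), mulB_mul, one_mul]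
  cases j.isRight <;> simp only [signIf, cond_true, cond_false] <;> noncomm_ring

/-- B and the cubics are odd, and passing to the dual index changes the parity of a variable, so the
two changes compensate. -/
lemma alphaCoeff_mem_homog (j k : Fin 4 ⊕ Fin 4) : alphaCoeff (X : _ → Poly F 4 4) j k ∈
    homog F (typeParity 4 4) (typeParity 4 4 j + typeParity 4 4 k) := by
  have h2 : (1 + 1 : ZMod 2) = 0 := rfl
  have hc := cubic_mem_homog F
  rw [cubic_eq_cubicOf] at hc
  have hs : (1 : ZMod 2) + typeParity 4 4 k.swap = typeParity 4 4 k := by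
    rcases k with k | k <;> simp [typeParity, h2]
  have hd : cubicDual (X : _ → Poly F 4 4) k ∈ homog F (typeParity 4 4) (typeParity 4 4 k) := by
    rcases k with k | k
    · exact (homog F (typeParity 4 4) _).zero_mem
    · exact hc (.inl k)
  have hk := X_mem_homog (F := F) (p := typeParity 4 4) k.swap
  rw [alphaCoeff, mulPhi, ← one_mul (X k.swap : Poly F 4 4), mulB_mul, one_mul]
  refine Submodule.add_mem _ (Submodule.add_mem _ ?_ (Submodule.neg_mem _ ?_)) (X_mul_mem_homog j hd)
  · exact X_mul_mem_homog j (mul_mem_homog (mulB_X_mem_homog F) hk hs)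
  · rcases j with j | j
    · exact mul_mem_homog (hc (.inl j)) (Submodule.add_mem _ hk hk) (hs.trans (zero_add _).symm)
    · rw [cubicOf, zero_mul]
      exact Submodule.zero_mem _

end AlphaBracket

end

end LieConformal

/-! ### The bracket of the α_i computed with operators -/

namespace LieConformal

open SuperPoly

noncomputable section

section Substitution

variable (F : Type*) [Field F] {ι : Type*} (p : ι → ZMod 2) (R : Type*) [AddCommGroup R] [Module F R]

/-- The algebra of operators on `F[λ] ⊗ R`. -/
def Operator : Type _ := Module.End F (SuperPoly F p ⊗[F] R)

instance : Ring (Operator F p R) := inferInstanceAs (Ring (Module.End F (SuperPoly F p ⊗[F] R)))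

instance : Algebra F (Operator F p R) :=
  inferInstanceAs (Algebra F (Module.End F (SuperPoly F p ⊗[F] R)))

instance : Module (Operator F p R) (SuperPoly F p ⊗[F] R) :=
  inferInstanceAs (Module (Module.End F (SuperPoly F p ⊗[F] R)) (SuperPoly F p ⊗[F] R))

variable [Module (SuperPoly F p) R] [IsScalarTower F (SuperPoly F p) R]

/-- The operators `λ_i` and `∂_i` on `F[λ] ⊗ R`. -/
def operators (b : Bool) (i : ι) : Operator F p R :=
  bif b then (parOp i : Module.End F (SuperPoly F p ⊗[F] R)) else lamOp i

/-- The substitution of the operators `λ_i` on `F[λ] ⊗ R` for the variables. -/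
def lamHom : SuperPoly F p →ₐ[F] Operator F p R :=
  (Algebra.lsmul F F (SuperPoly F p ⊗[F] R) : SuperPoly F p →ₐ[F] Module.End F _)

/-- The substitution of the operators `∂_i` on `F[λ] ⊗ R` for the variables. -/
def parHom : SuperPoly F p →ₐ[F] Operator F p R :=
  (lift parOp parOp_mul_parOp : SuperPoly F p →ₐ[F] Module.End F (SuperPoly F p ⊗[F] R))

/-- The substitution of the operators `λ_i + ∂_i` on `F[λ] ⊗ R` for the variables. -/
def addHom : SuperPoly F p →ₐ[F] Operator F p R :=
  (shift (1 : F) : SuperPoly F p →ₐ[F] Module.End F (SuperPoly F p ⊗[F] R))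

variable {F p R}

lemma lamHom_smul (P : SuperPoly F p) (t : SuperPoly F p ⊗[F] R) :
    lamHom F p R P • t = P • t := rfl

lemma lamHom_X (i : ι) : lamHom F p R (X i) = operators F p R false i :=
  LinearMap.ext fun t => (lamOp_eq_smul i t).symm

lemma parHom_X (i : ι) : parHom F p R (X i) = operators F p R true i :=
  lift_X (A := Module.End F (SuperPoly F p ⊗[F] R)) parOp parOp_mul_parOp i

lemma addHom_X (i : ι) :
    addHom F p R (X i) = (operators F p R false + operators F p R true) i :=
  (shift_X (1 : F) i).trans (one_smul F _)

lemma parHom_smul_tmul (Q : SuperPoly F p) (c : R) :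
    parHom F p R Q • (1 : SuperPoly F p) ⊗ₜ[F] c = (1 : SuperPoly F p) ⊗ₜ[F] (Q • c) := by
  induction Q using induction_X_mul with
  | one => rw [map_one, one_smul, one_smul]
  | add P Q hP hQ => rw [map_add, add_smul, hP, hQ, add_smul, TensorProduct.tmul_add]
  | smul t P hP =>
    rw [map_smul, smul_assoc t P c, TensorProduct.tmul_smul, ← hP]
    rfl
  | X_mul i P hP =>
    rw [map_mul, mul_smul, hP, parHom_X, mul_smul]
    change parOp i (1 ⊗ₜ[F] (P • c)) = _
    rw [parOp_tmul, map_one]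

lemma tmul_eq_lamHom_smul (P : SuperPoly F p) (c : R) :
    P ⊗ₜ[F] c = lamHom F p R P • (1 : SuperPoly F p) ⊗ₜ[F] c := by
  rw [lamHom_smul, TensorProduct.smul_tmul', smul_eq_mul, mul_one]

/-- The twist in the definition of the bracket is exactly the sign for moving λ_i + ∂_i to the left
of Q(λ + ∂). -/
lemma addHom_twist_mul (i : ι) (Q : SuperPoly F p) :
    addHom F p R (twist (p i) Q) * addHom F p R (X i) = addHom F p R (X i) * addHom F p R Q := by
  rw [← map_mul, ← map_mul, X_mul_eq]

end Substitution

section AlphaBracket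

variable (F : Type*) [Field F]

local notation "Op" => Operator F (typeParity 4 4) (RW F 4 4)
local notation "ℓ" => operators F (typeParity 4 4) (RW F 4 4) false
local notation "δ" => operators F (typeParity 4 4) (RW F 4 4) true
local notation "ω" => operators F (typeParity 4 4) (RW F 4 4) false +
  operators F (typeParity 4 4) (RW F 4 4) true

/-- Squares of odd operators vanish because their relation reads x² = -x² and 2 is invertible. -/
lemma isSuperPair_operators [CharZero F] :
    IsSuperPair (operators F (typeParity 4 4) (RW F 4 4)) where
  comm b c i j := by
    rw [← parSign_typeParity_smul F]
    cases b <;> cases c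
    · exact lamOp_mul_lamOp i j
    · exact lamOp_mul_parOp i j
    · exact parOp_mul_lamOp i j
    · exact parOp_mul_parOp i j
  sq b k := by
    have h : (X (Sum.inr k) * X (Sum.inr k) : Poly F 4 4) = 0 := X_sq_of_odd rfl
    cases b
    · rw [← lamHom_X, ← map_mul, h, map_zero]
    · rw [← parHom_X, ← map_mul, h, map_zero]

lemma lamHom_comp_X : (lamHom F (typeParity 4 4) (RW F 4 4) : Poly F 4 4 →+* Op) ∘ X = ℓ := funext lamHom_X

lemma parHom_comp_X : (parHom F (typeParity 4 4) (RW F 4 4) : Poly F 4 4 →+* Op) ∘ X = δ := funext parHom_X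

lemma addHom_comp_X : (addHom F (typeParity 4 4) (RW F 4 4) : Poly F 4 4 →+* Op) ∘ X = ω := funext addHom_X

lemma lamHom_alphaCoeff (i k : Fin 4 ⊕ Fin 4) :
    lamHom F (typeParity 4 4) (RW F 4 4) (alphaCoeff (X : _ → Poly F 4 4) i k) = alphaCoeff ℓ i k := by
  rw [← lamHom_comp_X]
  exact map_alphaCoeff (lamHom F (typeParity 4 4) (RW F 4 4) : Poly F 4 4 →+* Op) _ _ _

lemma parHom_alphaCoeff (i k : Fin 4 ⊕ Fin 4) :
    parHom F (typeParity 4 4) (RW F 4 4) (alphaCoeff (X : _ → Poly F 4 4) i k) = alphaCoeff δ i k := by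
  rw [← parHom_comp_X]
  exact map_alphaCoeff (parHom F (typeParity 4 4) (RW F 4 4) : Poly F 4 4 →+* Op) _ _ _

lemma addHom_alphaCoeff (i k : Fin 4 ⊕ Fin 4) :
    addHom F (typeParity 4 4) (RW F 4 4) (alphaCoeff (X : _ → Poly F 4 4) i k) = alphaCoeff (ω) i k := by
  rw [← addHom_comp_X]
  exact map_alphaCoeff (addHom F (typeParity 4 4) (RW F 4 4) : Poly F 4 4 →+* Op) _ _ _

lemma neg_alphaCoeff (i k : Fin 4 ⊕ Fin 4) :
    neg (alphaCoeff (X : _ → Poly F 4 4) i k) = alphaCoeff X i k := by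
  have h : ((neg : Poly F 4 4 →ₐ[F] Poly F 4 4) : Poly F 4 4 →+* Poly F 4 4) ∘ X = -X :=
    funext neg_X
  have h' := map_alphaCoeff ((neg : Poly F 4 4 →ₐ[F] Poly F 4 4) : Poly F 4 4 →+* Poly F 4 4) X i k
  rwa [h, alphaCoeff_neg] at h'

/-- The element `1 ⊗ a_k`. -/
def oneGen (k : Fin 4 ⊕ Fin 4) : Poly F 4 4 ⊗[F] RW F 4 4 := 1 ⊗ₜ rwGen F 4 4 k

lemma rwGenBr_eq (n k : Fin 4 ⊕ Fin 4) : rwGenBr F 4 4 n k =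
    addHom F (typeParity 4 4) (RW F 4 4) (X n) • oneGen F k +
      signIf (n.isRight && k.isRight) (ℓ k) • oneGen F n := by
  rw [← parSign_typeParity_smul F, addHom_X]
  change _ = lamOp n (oneGen F k) + parOp n (oneGen F k) +
    parSign F (typeParity 4 4 n * typeParity 4 4 k) • lamOp k (oneGen F n)
  rw [rwGenBr, oneGen, oneGen, lamOp_tmul, lamOp_tmul, parOp_tmul, map_one,
    mul_one, mul_one, add_comm (X n ⊗ₜ[F] rwGen F 4 4 k)]

/-- The contribution of the coefficients of a_n in α_i and a_k in α_j. In the second summand the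
twist gives the sign of p_n (p_j + p_k) and the bracket of generators that of p_n p_k, leaving p_j
p_n. -/
lemma rwBr_alpha_term (i j n k : Fin 4 ⊕ Fin 4) : neg (alpha F i n) •
      shift (1 : F) (twist (typeParity 4 4 n) (alpha F j k)) (rwGenBr F 4 4 n k) =
      (alphaCoeff ℓ i n * ((ω) n * alphaCoeff (ω) j k)) • oneGen F k +
      (signIf (j.isRight && n.isRight) (alphaCoeff ℓ i n *
        (alphaCoeff (ω) j k * (ℓ k * 1)))) • oneGen F n := by
  have h1 : addHom F (typeParity 4 4) (RW F 4 4) (twist (typeParity 4 4 n) (alpha F j k)) *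
      addHom F (typeParity 4 4) (RW F 4 4) (X n) = (ω) n * alphaCoeff (ω) j k := by
    rw [addHom_twist_mul, alpha_apply, addHom_alphaCoeff, addHom_X]
  have h2 : addHom F (typeParity 4 4) (RW F 4 4) (twist (typeParity 4 4 n) (alpha F j k)) *
      signIf (n.isRight && k.isRight) (ℓ k) =
      signIf (j.isRight && n.isRight) (alphaCoeff (ω) j k * ℓ k) := by
    rw [alpha_apply, twist_of_mem_homog (alphaCoeff_mem_homog F j k), map_smul, addHom_alphaCoeff,
      ← parSign_typeParity_smul F, ← parSign_typeParity_smul F, smul_mul_smul_comm, mul_add,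
      parSign_add, mul_assoc, parSign_mul_self, mul_one, mul_comm (typeParity 4 4 j)]
  change lamHom F (typeParity 4 4) (RW F 4 4) (neg (alpha F i n)) •
    addHom F (typeParity 4 4) (RW F 4 4) (twist (typeParity 4 4 n) (alpha F j k)) • rwGenBr F 4 4 n k = _
  rw [rwGenBr_eq, smul_add, smul_smul, smul_smul, h1, h2, alpha_apply, neg_alphaCoeff,
    lamHom_alphaCoeff, smul_add, smul_smul, smul_smul, mul_signIf, mul_one]

/-- Terms are collected by generator: the first kind ends in the generator from α_j and is summed
over the index from α_i, the second kind the other way round. -/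
lemma rwBr_alpha_eq (i j : Fin 4 ⊕ Fin 4) : rwBr F 4 4 (alpha F i) (alpha F j) =
    ∑ k, (mulAlpha ℓ (ω) i (alphaCoeff (ω) j k) +
      signIf (j.isRight && k.isRight) (alphaCoeff ℓ i k * mulAlpha (ω) ℓ j 1)) • oneGen F k := by
  have h1 : ∀ k, ∑ n, (alphaCoeff ℓ i n * ((ω) n * alphaCoeff (ω) j k)) • oneGen F k =
      mulAlpha ℓ (ω) i (alphaCoeff (ω) j k) • oneGen F k := fun k => by
    rw [mulAlpha_eq_sum, Finset.sum_smul]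
  have h2 : ∀ n, ∑ k, signIf (j.isRight && n.isRight) (alphaCoeff ℓ i n *
      (alphaCoeff (ω) j k * (ℓ k * 1))) • oneGen F n =
      signIf (j.isRight && n.isRight) (alphaCoeff ℓ i n * mulAlpha (ω) ℓ j 1) • oneGen F n :=
    fun n => by
      rw [mulAlpha_eq_sum, ← Finset.sum_smul, Finset.mul_sum]
      cases (j.isRight && n.isRight)
      · rfl
      · exact congrArg (· • oneGen F n) (Finset.sum_neg_distrib _)
  rw [rwBr_apply, Finset.sum_congr rfl fun n _ => Finset.sum_congr rfl fun k _ =>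
    rwBr_alpha_term F i j n k, Finset.sum_congr rfl fun n _ => Finset.sum_add_distrib,
    Finset.sum_add_distrib, Finset.sum_congr rfl fun n _ => h2 n, Finset.sum_comm,
    Finset.sum_congr rfl fun k _ => h1 k, ← Finset.sum_add_distrib]
  exact Finset.sum_congr rfl fun k _ => (add_smul _ _ _).symm

lemma one_tmul_eq_sum (c : RW F 4 4) : (1 : Poly F 4 4) ⊗ₜ[F] c =
    ∑ k, parHom F (typeParity 4 4) (RW F 4 4) (c k) • oneGen F k := by
  conv_lhs => rw [← sum_smul_rwGen F 4 4 c, TensorProduct.tmul_sum]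
  exact Finset.sum_congr rfl fun k _ => (parHom_smul_tmul _ _).symm

lemma one_tmul_alpha (j : Fin 4 ⊕ Fin 4) : (1 : Poly F 4 4) ⊗ₜ[F] alpha F j =
    ∑ k, alphaCoeff δ j k • oneGen F k := by
  rw [one_tmul_eq_sum]
  exact Finset.sum_congr rfl fun k _ => by rw [alpha_apply, parHom_alphaCoeff]

lemma sum_tmul_alpha {u : Fin 4 ⊕ Fin 4 → Poly F 4 4} {v : Fin 4 ⊕ Fin 4 → Op}
    (hv : ∀ n, lamHom F (typeParity 4 4) (RW F 4 4) (u n) = v n) :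
    ∑ n, u n ⊗ₜ[F] alpha F n.swap = ∑ k, alphaSum v δ k • oneGen F k := by
  simp only [alphaSum, sumAll_eq_sum, Finset.sum_smul]
  rw [Finset.sum_comm]
  refine Finset.sum_congr rfl fun n _ => ?_
  rw [tmul_eq_lamHom_smul, hv, one_tmul_alpha, Finset.smul_sum]
  exact Finset.sum_congr rfl fun k _ => smul_smul _ _ _

lemma actOn_pairC (x : RW F 4 4) {u : Fin 4 ⊕ Fin 4 → Poly F 4 4} {v : Fin 4 ⊕ Fin 4 → Op}
    (hv : ∀ n, lamHom F (typeParity 4 4) (RW F 4 4) (u n) = v n) :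
    actOn F x (pairC (fun P Q => P ⊗ₜ[F] Q) u X) =
      mulC v δ 1 • (1 : Poly F 4 4) ⊗ₜ[F] x := by
  rw [pairC_eq_sum, map_sum, mulC_eq_sum, Finset.sum_smul]
  refine Finset.sum_congr rfl fun n _ => ?_
  change u n ⊗ₜ[F] ((X n.swap : Poly F 4 4) • x) = _
  rw [tmul_eq_lamHom_smul, hv, ← parHom_smul_tmul, parHom_X, mul_one, smul_smul]

lemma actOn_smul (x : RW F 4 4) (P : Poly F 4 4) (t : Poly F 4 4 ⊗[F] Poly F 4 4) :
    actOn F x (P • t) = lamHom F (typeParity 4 4) (RW F 4 4) P • actOn F x t := by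
  rw [lamHom_smul]
  induction t with
  | zero => rw [smul_zero, map_zero, smul_zero]
  | tmul Q c => rfl
  | add x y hx hy => rw [smul_add, map_add, map_add, smul_add, hx, hy]

lemma lamHom_cubicOf (n : Fin 4 ⊕ Fin 4) :
    lamHom F (typeParity 4 4) (RW F 4 4) (cubicOf (X : _ → Poly F 4 4) n) = cubicOf ℓ n := by
  rw [← lamHom_comp_X]
  exact map_cubicOf (lamHom F (typeParity 4 4) (RW F 4 4) : Poly F 4 4 →+* Op) _ _

theorem rwBr_alpha [CharZero F] (i j : Fin 4 ⊕ Fin 4) :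
    rwBr F 4 4 (alpha F i) (alpha F j) =
      (X i * X j * pairB (· * ·) X X - 2 * X i * cubic F j - 2 * X j * cubic F i : Poly F 4 4) •
          pairC (fun P x => P ⊗ₜ[F] x) X (alpha F)
        + (3 * X i * X j : Poly F 4 4) • pairB (fun P x => P ⊗ₜ[F] x) (cubic F) (alpha F)
        + actOn F (alpha F j)
            ((X i : Poly F 4 4) • pairC (fun P Q => P ⊗ₜ[F] Q) (cubic F) X
              + (X i * pairB (· * ·) X X : Poly F 4 4) • pairC (fun P Q => P ⊗ₜ[F] Q) X X
              - (2 * cubic F i) • pairC (fun P Q => P ⊗ₜ[F] Q) X X) := by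
  have hc := lamHom_cubicOf F
  have hm : ∀ P : Poly F 4 4, ∀ f : Fin 4 ⊕ Fin 4 → Op,
      P • ∑ k, f k • oneGen F k = ∑ k, (lamHom F (typeParity 4 4) (RW F 4 4) P * f k) • oneGen F k :=
    fun P f => by
      rw [← lamHom_smul, Finset.smul_sum]
      exact Finset.sum_congr rfl fun k _ => smul_smul _ _ _
  have h1 : pairC (fun P x => P ⊗ₜ[F] x) X (alpha F) = ∑ k, alphaSum ℓ δ k • oneGen F k := by
    rw [pairC_eq_sum]
    exact sum_tmul_alpha F lamHom_X
  have h2 : pairB (fun P x => P ⊗ₜ[F] x) (cubicOf X) (alpha F) =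
      ∑ k, alphaSum (cubicOf ℓ) δ k • oneGen F k := by
    rw [pairB_cubic_eq_sum _ (fun v => TensorProduct.zero_tmul _ v) _ (fun _ => rfl)]
    exact sum_tmul_alpha F hc
  have hS : lamHom F (typeParity 4 4) (RW F 4 4)
      (signIf j.isRight (mulPhi X i (X j)) - 2 * (X i * cubicOf X j)) =
      signIf j.isRight (mulPhi ℓ i (ℓ j)) - 2 * (ℓ i * cubicOf ℓ j) := by
    have hs : lamHom F (typeParity 4 4) (RW F 4 4) (mulPhi X i (X j)) = mulPhi ℓ i (ℓ j) := by
      rw [← lamHom_X, ← lamHom_comp_X]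
      exact map_mulPhi (lamHom F (typeParity 4 4) (RW F 4 4) : Poly F 4 4 →+* Op) _ _ _
    rw [map_sub, map_mul, map_mul, hc, lamHom_X, map_ofNat]
    cases j.isRight
    · exact congrArg (· - _) hs
    · exact congrArg (· - _) ((map_neg _ _).trans (congrArg Neg.neg hs))
  have hB : lamHom F (typeParity 4 4) (RW F 4 4) (mulB X X 1) = mulB ℓ ℓ 1 := by
    rw [← lamHom_comp_X, ← map_one (lamHom F (typeParity 4 4) (RW F 4 4))]
    exact map_mulB (lamHom F (typeParity 4 4) (RW F 4 4) : Poly F 4 4 →+* Op) _ _ _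
  -- The operator applied to α_j on the right side is α_i(λ) with each a_k replaced by ∂_k.
  have h3 : ℓ i * mulC (cubicOf ℓ) δ 1 + ℓ i * mulB ℓ ℓ 1 * mulC ℓ δ 1 -
      2 * cubicOf ℓ i * mulC ℓ δ 1 = mulAlpha ℓ δ i 1 := by
    -- C reduces to B because μ_5, …, μ_8 vanish.
    have hC : mulC (cubicOf ℓ) δ 1 = mulB (cubicOf ℓ) δ 1 := by
      simp [mulC, cubicOf]
    rw [mulAlpha, mulPhi, hC, ← one_mul (mulC ℓ δ 1), mulB_mul, one_mul]
    noncomm_ring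
  have h4 : ∀ r, mulAlpha ℓ δ i 1 * r = mulAlpha ℓ δ i r := fun r => by
    simp only [mulAlpha_eq_sum, Finset.sum_mul, mul_assoc, one_mul]
  rw [rwBr_alpha_eq, first_coeff_eq, cubic_eq_cubicOf, pairB_mul, h1, h2, map_sub, map_add,
    actOn_smul, actOn_smul, actOn_smul, actOn_pairC F _ hc, actOn_pairC F _ lamHom_X, smul_smul,
    smul_smul, smul_smul, ← add_smul, ← sub_smul, map_mul, map_mul, hB, hc, lamHom_X, map_ofNat,
    h3, one_tmul_alpha, hm, hm, Finset.smul_sum, hS, map_mul, map_mul, lamHom_X, lamHom_X,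
    map_ofNat, ← Finset.sum_add_distrib, ← Finset.sum_add_distrib]
  refine Finset.sum_congr rfl fun k _ => ?_
  rw [smul_smul, ← add_smul, ← add_smul,
    alpha_bracket_coeff (isSuperPair_operators F) i j k rfl rfl rfl, sub_mul, mul_assoc 3 (ℓ i), h4]

end AlphaBracket

end

end LieConformal

/-! ### Restriction of the structure to graded submodules -/

namespace LieConformal

open SuperPoly

noncomputable section

section Parity

variable {F : Type*} [Field F] {ι : Type*} {p : ι → ZMod 2}
  {R : Type*} [AddCommGroup R] [Module F R]

lemma exists_parity {gr : ZMod 2 → Submodule F R} (h : IsCompl (gr 0) (gr 1)) :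
    ∃ π : R →ₗ[F] R, ∀ ε, ∀ a ∈ gr ε, π a = parSign F ε • a := by
  refine ⟨LinearMap.ofIsCompl h (gr 0).subtype (-(gr 1).subtype), fun ε a ha => ?_⟩
  rcases zmod_two_cases ε with rfl | rfl
  · rw [parSign_zero, one_smul]
    exact LinearMap.ofIsCompl_apply_left h ⟨a, ha⟩
  · rw [parSign_one, neg_one_smul]
    exact LinearMap.ofIsCompl_apply_right h ⟨a, ha⟩

/-- The tensor product of the parity involutions of F[λ] and R acts by opposite signs on the two
parts, so a common element is killed by 2. -/
lemma disjoint_tensorGr [CharZero F] {gr : ZMod 2 → Submodule F R} (h : IsCompl (gr 0) (gr 1))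
    (η : ZMod 2) : Disjoint (tensorGr (p := p) gr η) (tensorGr gr (η + 1)) := by
  obtain ⟨π, hπ⟩ := exists_parity h
  have key : ∀ ε, ∀ t ∈ tensorGr (p := p) gr ε,
      TensorProduct.map (twist (1 : ZMod 2)).toLinearMap π t = parSign F ε • t := by
    intro ε t ht
    induction ht using Submodule.span_induction with
    | zero => simp
    | mem t h =>
      obtain ⟨γ, δ, rfl, P, hP, c, hc, rfl⟩ := h
      rw [TensorProduct.map_tmul, AlgHom.toLinearMap_apply, twist_of_mem_homog hP, hπ δ c hc,
        one_mul, TensorProduct.smul_tmul_smul, parSign_add]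
    | add x y _ _ hx hy => rw [map_add, hx, hy, smul_add]
    | smul s x _ hx => rw [map_smul, hx, smul_comm]
  rw [Submodule.disjoint_def]
  intro t h0 h1
  have e := (key _ t h0).symm.trans (key _ t h1)
  rw [parSign_add, parSign_one, mul_neg_one] at e
  have e2 : (2 * parSign F η) • t = 0 := by
    rw [two_mul, add_smul]
    nth_rewrite 2 [e]
    rw [← add_smul, add_neg_cancel, zero_smul]
  refine (smul_eq_zero_iff_right (mul_ne_zero (two_ne_zero : (2 : F) ≠ 0) ?_)).mp e2
  exact left_ne_zero_of_mul (parSign_mul_self F η ▸ one_ne_zero)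

lemma exists_tensorGr_add {gr : ZMod 2 → Submodule F R} (h : Codisjoint (gr 0) (gr 1))
    (η : ZMod 2) (t : SuperPoly F p ⊗[F] R) :
    ∃ t₀ ∈ tensorGr gr η, ∃ t₁ ∈ tensorGr gr (η + 1), t₀ + t₁ = t := by
  rw [← Submodule.mem_sup]
  have hη : ∀ ε, tensorGr (p := p) gr ε ≤ tensorGr gr η ⊔ tensorGr gr (η + 1) := by
    intro ε
    have : ε = η ∨ ε = η + 1 := by
      revert ε η
      decide
    rcases this with rfl | rfl
    · exact le_sup_left
    · exact le_sup_right
  induction t with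
  | zero => exact zero_mem _
  | add x y hx hy => exact add_mem hx hy
  | tmul P c =>
    obtain ⟨P₀, hP₀, P₁, hP₁, rfl⟩ := Submodule.mem_sup.mp (exists_homog_add P)
    obtain ⟨c₀, hc₀, c₁, hc₁, rfl⟩ := Submodule.mem_sup.mp
      (Submodule.eq_top_iff'.mp (codisjoint_iff.mp h) c)
    rw [TensorProduct.add_tmul, TensorProduct.tmul_add, TensorProduct.tmul_add]
    exact add_mem
      (add_mem (hη _ (Submodule.subset_span ⟨_, _, rfl, _, hP₀, _, hc₀, rfl⟩))
        (hη _ (Submodule.subset_span ⟨_, _, rfl, _, hP₀, _, hc₁, rfl⟩)))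
      (add_mem (hη _ (Submodule.subset_span ⟨_, _, rfl, _, hP₁, _, hc₀, rfl⟩))
        (hη _ (Submodule.subset_span ⟨_, _, rfl, _, hP₁, _, hc₁, rfl⟩)))

end Parity

section Naturality

variable {F : Type*} [Field F] {ι : Type*} {p : ι → ZMod 2}
  {R S : Type*} [AddCommGroup R] [Module F R] [AddCommGroup S] [Module F S]

lemma lTensor_mem_tensorGr {gr : ZMod 2 → Submodule F R} (f : S →ₗ[F] R) {η : ZMod 2}
    {t : SuperPoly F p ⊗[F] S} (ht : t ∈ tensorGr (fun ε => (gr ε).comap f) η) :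
    LinearMap.lTensor (SuperPoly F p) f t ∈ tensorGr gr η := by
  induction ht using Submodule.span_induction with
  | zero => simp
  | mem t h =>
    obtain ⟨γ, δ, rfl, P, hP, c, hc, rfl⟩ := h
    exact Submodule.subset_span ⟨γ, δ, rfl, P, hP, f c, hc, rfl⟩
  | add x y _ _ hx hy => rw [map_add]; exact add_mem hx hy
  | smul s x _ hx => rw [map_smul]; exact Submodule.smul_mem _ s hx

/-- Split t into its two parities in F[λ] ⊗ S. The image of the part of the wrong parity lies in
both parities of F[λ] ⊗ R, so it is zero, and injectivity applies. -/
lemma mem_tensorGr_of_lTensor [CharZero F] {gr : ZMod 2 → Submodule F R} (f : S →ₗ[F] R)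
    (hf : Function.Injective (LinearMap.lTensor (SuperPoly F p) f)) (h : IsCompl (gr 0) (gr 1))
    (h' : Codisjoint ((gr 0).comap f) ((gr 1).comap f)) {η : ZMod 2} {t : SuperPoly F p ⊗[F] S}
    (ht : LinearMap.lTensor (SuperPoly F p) f t ∈ tensorGr gr η) :
    t ∈ tensorGr (fun ε => (gr ε).comap f) η := by
  obtain ⟨t₀, h₀, t₁, h₁, rfl⟩ :=
    exists_tensorGr_add (gr := fun ε => (gr ε).comap f) h' η t
  have e₀ := lTensor_mem_tensorGr f h₀
  have e₁ := lTensor_mem_tensorGr f h₁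
  rw [map_add, Submodule.add_mem_iff_right _ e₀] at ht
  have := Submodule.disjoint_def.mp (disjoint_tensorGr h η) _ ht e₁
  rw [map_eq_zero_iff _ hf] at this
  rwa [this, add_zero]

lemma lTensor_smul (f : S →ₗ[F] R) (P : SuperPoly F p) (t : SuperPoly F p ⊗[F] S) :
    LinearMap.lTensor (SuperPoly F p) f (P • t) = P • LinearMap.lTensor (SuperPoly F p) f t := by
  induction t with
  | zero => simp
  | tmul Q c => rfl
  | add x y hx hy => rw [smul_add, map_add, map_add, smul_add, hx, hy]

lemma lTensor_extend (f : S →ₗ[F] R) (g h : SuperPoly F p →ₐ[F] SuperPoly F (Sum.elim p p))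
    {T : S →ₗ[F] SuperPoly F p ⊗[F] S} {T' : R →ₗ[F] SuperPoly F p ⊗[F] R}
    (hT : ∀ c, LinearMap.lTensor (SuperPoly F p) f (T c) = T' (f c)) (t : SuperPoly F p ⊗[F] S) :
    LinearMap.lTensor (SuperPoly F (Sum.elim p p)) f (extend g h T t) =
      extend g h T' (LinearMap.lTensor (SuperPoly F p) f t) := by
  induction t with
  | zero => simp
  | tmul P c =>
    rw [LinearMap.lTensor_tmul, extend_tmul, extend_tmul, lTensor_smul, ← hT]
    congr 1
    exact DFunLike.congr_fun (LinearMap.lTensor_comp_rTensor (f := g.toLinearMap) (g := f)) (T c) |>.trans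
      (DFunLike.congr_fun (LinearMap.rTensor_comp_lTensor (f := g.toLinearMap) (g := f)) (T c)).symm
  | add x y hx hy => simp only [map_add, hx, hy]

lemma lTensor_lamOp (f : S →ₗ[F] R) (i : ι) (t : SuperPoly F p ⊗[F] S) :
    LinearMap.lTensor (SuperPoly F p) f (lamOp i t) =
      lamOp i (LinearMap.lTensor (SuperPoly F p) f t) := by
  rw [lamOp_eq_smul, lamOp_eq_smul, lTensor_smul]

variable [Module (SuperPoly F p) R] [IsScalarTower F (SuperPoly F p) R]
  [Module (SuperPoly F p) S] [IsScalarTower F (SuperPoly F p) S]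

lemma lTensor_parOp (f : S →ₗ[SuperPoly F p] R) (i : ι) (t : SuperPoly F p ⊗[F] S) :
    LinearMap.lTensor (SuperPoly F p) (f.restrictScalars F) (parOp i t) =
      parOp i (LinearMap.lTensor (SuperPoly F p) (f.restrictScalars F) t) := by
  induction t with
  | zero => simp
  | tmul Q c => simp
  | add x y hx hy => simp only [map_add, hx, hy]

lemma lTensor_shift (f : S →ₗ[SuperPoly F p] R) (s : F) (P : SuperPoly F p)
    (t : SuperPoly F p ⊗[F] S) :
    LinearMap.lTensor (SuperPoly F p) (f.restrictScalars F) (shift s P t) =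
      shift s P (LinearMap.lTensor (SuperPoly F p) (f.restrictScalars F) t) := by
  induction P using induction_X_mul generalizing t with
  | one => simp
  | add P Q hP hQ => simp only [map_add, LinearMap.add_apply, hP, hQ]
  | smul u P hP => simp only [map_smul, LinearMap.smul_apply, hP]
  | X_mul i P hP =>
    simp only [map_mul, Module.End.mul_apply, shift_X, LinearMap.smul_apply, LinearMap.add_apply,
      map_smul, map_add, lTensor_lamOp, lTensor_parOp, hP]

lemma lTensor_substNeg (f : S →ₗ[SuperPoly F p] R) (t : SuperPoly F p ⊗[F] S) :
    LinearMap.lTensor (SuperPoly F p) (f.restrictScalars F) (substNeg t) =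
      substNeg (LinearMap.lTensor (SuperPoly F p) (f.restrictScalars F) t) := by
  induction t with
  | zero => simp
  | tmul Q c => rw [substNeg_tmul, lTensor_shift]; rfl
  | add x y hx hy => simp only [map_add, hx, hy]

end Naturality

section Subalgebra

variable {F : Type*} [Field F] {ι : Type*} {p : ι → ZMod 2}
  {R : Type*} [AddCommGroup R] [Module F R] [Module (SuperPoly F p) R]
  [IsScalarTower F (SuperPoly F p) R]
  {gr : ZMod 2 → Submodule F R} {br : R →ₗ[F] R →ₗ[F] SuperPoly F p ⊗[F] R}

/-- A graded submodule that is closed under the bracket is a subalgebra. -/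
theorem IsLieConformalSuperalgebra.isSubalgebra [CharZero F]
    (h : IsLieConformalSuperalgebra gr br) (S : Submodule (SuperPoly F p) R)
    (hS : ∀ a ∈ S, ∃ a₀ ∈ S, a₀ ∈ gr 0 ∧ ∃ a₁ ∈ S, a₁ ∈ gr 1 ∧ a₀ + a₁ = a)
    (hbr : ∀ a ∈ S, ∀ b ∈ S, br a b ∈
      LinearMap.range (LinearMap.lTensor (SuperPoly F p) (S.subtype.restrictScalars F))) :
    IsLieConformalSubalgebra gr br S := by
  let f := S.subtype.restrictScalars F
  have hf : Function.Injective f := S.subtype_injective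
  -- Every module over a field is flat. Injectivity makes the restricted bracket unique, hence
  -- bilinear, and reduces each axiom for S to the one for R; `h2` serves the Jacobi identity in two
  -- sets of variables.
  have h1 : Function.Injective (LinearMap.lTensor (SuperPoly F p) f) :=
    Module.Flat.lTensor_preserves_injective_linearMap f hf
  have h2 : Function.Injective (LinearMap.lTensor (SuperPoly F (Sum.elim p p)) f) :=
    Module.Flat.lTensor_preserves_injective_linearMap f hf
  have hbr' : ∀ a b : S, ∃ t, LinearMap.lTensor (SuperPoly F p) f t = br (a : R) (b : R) :=
    fun a b => hbr a a.2 b b.2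
  choose B hB using hbr'
  let brS : S →ₗ[F] S →ₗ[F] SuperPoly F p ⊗[F] S := LinearMap.mk₂ F B
    (fun a a' b => h1 (by rw [map_add, hB, hB, hB]; simp))
    (fun t a b => h1 (by rw [map_smul, hB, hB]; simp))
    (fun a b b' => h1 (by rw [map_add, hB, hB, hB]; simp))
    (fun t a b => h1 (by rw [map_smul, hB, hB]; simp))
  have hbrS : ∀ a b : S, LinearMap.lTensor (SuperPoly F p) f (brS a b) = br (a : R) (b : R) := hB
  have hcod : Codisjoint ((gr 0).comap f) ((gr 1).comap f) := by
    rw [codisjoint_iff, Submodule.eq_top_iff']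
    rintro ⟨a, ha⟩
    obtain ⟨a₀, hS₀, h₀, a₁, hS₁, h₁, rfl⟩ := hS a ha
    exact Submodule.mem_sup.mpr ⟨⟨a₀, hS₀⟩, h₀, ⟨a₁, hS₁⟩, h₁, rfl⟩
  refine ⟨brS, hbrS, ?_, ?_, ?_, ?_, ?_, ?_, ?_⟩
  · refine ⟨?_, hcod⟩
    rw [Submodule.disjoint_def]
    exact fun a h₀ h₁ => hf (Submodule.disjoint_def.mp h.isCompl.disjoint _ h₀ h₁)
  · exact fun i ε a ha => h.smul_mem i ε a ha
  · intro ε δ a b ha hb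
    exact mem_tensorGr_of_lTensor f h1 h.isCompl hcod (hbrS a b ▸ h.bracket_mem ε δ a b ha hb)
  · intro i a b
    apply h1
    rw [map_neg, lTensor_lamOp, hbrS, hbrS]
    exact h.sesq_left i a b
  · intro i ε a b ha
    apply h1
    rw [hbrS]
    refine (h.sesq_right i ε a b ha).trans ?_
    rw [map_smul, map_add, lTensor_lamOp, lTensor_parOp, hbrS]
  · intro ε δ a b ha hb
    apply h1
    rw [map_neg, map_smul, lTensor_substNeg, hbrS, hbrS]
    exact h.skew ε δ a b ha hb
  · intro ε δ a b c ha hb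
    apply h2
    rw [map_add, map_smul, lTensor_extend f _ _ (hbrS a), lTensor_extend f _ _ (hbrS b),
      lTensor_extend f _ _ (T' := br.flip c) (fun x => hbrS x c), hbrS, hbrS, hbrS]
    exact h.jacobi ε δ a b c ha hb

/-- A submodule generated by homogeneous elements whose brackets lie in it is a subalgebra. -/
theorem IsLieConformalSuperalgebra.isSubalgebra_span [CharZero F]
    (h : IsLieConformalSuperalgebra gr br) {κ : Type*} {e : κ → R} {q : κ → ZMod 2}
    (he : ∀ k, e k ∈ gr (q k))
    (hbr : ∀ k l, br (e k) (e l) ∈ LinearMap.range (LinearMap.lTensor (SuperPoly F p)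
      ((Submodule.span (SuperPoly F p) (Set.range e)).subtype.restrictScalars F))) :
    IsLieConformalSubalgebra gr br (Submodule.span (SuperPoly F p) (Set.range e)) := by
  set S := Submodule.span (SuperPoly F p) (Set.range e)
  set N := LinearMap.range (LinearMap.lTensor (SuperPoly F p) (S.subtype.restrictScalars F))
  let H := homSpan (F := F) (p := p) e q
  have hgr : ∀ ε, ∀ a ∈ H ε, a ∈ gr ε := fun ε a ha =>
    homSpan_induction (C := fun ε a => a ∈ gr ε) (fun ε => zero_mem _)
      (fun ε a b ha hb => add_mem ha hb) (fun ε t a ha => Submodule.smul_mem _ t ha) he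
      (fun i ε a ha => h.smul_mem i ε a ha) ha
  have hHS : ∀ ε, ∀ a ∈ H ε, a ∈ S := fun ε a ha =>
    homSpan_induction (C := fun _ a => a ∈ S) (fun ε => zero_mem _)
      (fun ε a b ha hb => add_mem ha hb)
      (fun ε t a ha => by
        rw [← one_smul (SuperPoly F p) a, ← smul_assoc]
        exact S.smul_mem _ ha)
      (fun k => Submodule.subset_span ⟨k, rfl⟩) (fun i ε a ha => S.smul_mem _ ha) ha
  have hX : ∀ (i : ι) (ε : ZMod 2), ∀ a ∈ H ε, (X i : SuperPoly F p) • a ∈ H (p i + ε) :=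
    fun i ε a ha => by
      induction ha using Submodule.span_induction with
      | zero => rw [smul_zero]; exact zero_mem _
      | mem a ha =>
        obtain ⟨K, k, rfl, rfl⟩ := ha
        exact Submodule.subset_span ⟨i :: K, k, by simp [add_assoc], by simp [mul_smul]⟩
      | add a b _ _ ha hb => rw [smul_add]; exact add_mem ha hb
      | smul t a _ ha => rw [smul_comm]; exact Submodule.smul_mem _ t ha
  -- The sum of the two parts contains the generators and is stable under all variables, hence under
  -- F[∂].
  have hsup : ∀ a ∈ S, a ∈ H 0 ⊔ H 1 := by
    intro a ha
    induction ha using Submodule.span_induction with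
    | zero => exact zero_mem _
    | add x y _ _ hx hy => exact add_mem hx hy
    | mem a ha =>
      obtain ⟨k, rfl⟩ := ha
      have hk : e k ∈ H (q k) := Submodule.subset_span ⟨[], k, by simp, by simp⟩
      rcases zmod_two_cases (q k) with hq | hq <;> rw [hq] at hk
      · exact Submodule.mem_sup_left hk
      · exact Submodule.mem_sup_right hk
    | smul P x _ hx =>
      refine smul_mem_of_X_smul_mem (fun i m hm => ?_) P hx
      obtain ⟨a, ha, b, hb, rfl⟩ := Submodule.mem_sup.mp hm
      rw [smul_add]
      have h1 := hX i 0 a ha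
      have h2 := hX i 1 b hb
      rcases zmod_two_cases (p i) with h | h <;> rw [h] at h1 h2
      · exact add_mem (Submodule.mem_sup_left h1) (Submodule.mem_sup_right h2)
      · exact add_mem (Submodule.mem_sup_right h1) (Submodule.mem_sup_left h2)
  have hlam : ∀ i, ∀ t ∈ N, lamOp i t ∈ N := by
    rintro i _ ⟨t, rfl⟩
    exact ⟨lamOp i t, lTensor_lamOp _ i t⟩
  have hpar : ∀ i, ∀ t ∈ N, parOp i t ∈ N := by
    rintro i _ ⟨t, rfl⟩
    exact ⟨parOp i t, lTensor_parOp _ i t⟩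
  -- N is stable under λ_i and ∂_i, so closure spreads by sesquilinearity from the generators, first
  -- in the left argument and then in the right one, where the left must be homogeneous.
  have hl : ∀ l ε, ∀ a ∈ H ε, br a (e l) ∈ N := fun l ε a ha =>
    homSpan_induction (C := fun _ a => br a (e l) ∈ N)
      (fun ε => by rw [map_zero, LinearMap.zero_apply]; exact zero_mem _)
      (fun ε a b ha hb => by rw [map_add, LinearMap.add_apply]; exact add_mem ha hb)
      (fun ε t a ha => by rw [map_smul, LinearMap.smul_apply]; exact N.smul_mem t ha)
      (fun k => hbr k l)
      (fun i ε a ha => by rw [h.sesq_left]; exact neg_mem (hlam i _ ha)) ha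
  have hlr : ∀ ε δ, ∀ a ∈ H ε, ∀ b ∈ H δ, br a b ∈ N := fun ε δ a ha b hb =>
    homSpan_induction (C := fun _ b => br a b ∈ N)
      (fun ε => by rw [map_zero]; exact zero_mem _)
      (fun ε b b' hb hb' => by rw [map_add]; exact add_mem hb hb')
      (fun ε t b hb => by rw [map_smul]; exact N.smul_mem t hb)
      (fun l => hl l ε a ha)
      (fun i δ b hb => by
        rw [h.sesq_right i ε a b (hgr ε a ha)]
        exact N.smul_mem _ (add_mem (hpar i _ hb) (hlam i _ hb))) hb
  refine h.isSubalgebra S (fun a ha => ?_) fun a ha b hb => ?_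
  · obtain ⟨a₀, h₀, a₁, h₁, rfl⟩ := Submodule.mem_sup.mp (hsup a ha)
    exact ⟨a₀, hHS 0 _ h₀, hgr 0 _ h₀, a₁, hHS 1 _ h₁, hgr 1 _ h₁, rfl⟩
  · obtain ⟨a₀, h₀, a₁, h₁, rfl⟩ := Submodule.mem_sup.mp (hsup a ha)
    obtain ⟨b₀, h₀', b₁, h₁', rfl⟩ := Submodule.mem_sup.mp (hsup b hb)
    simp only [map_add, LinearMap.add_apply]
    exact add_mem (add_mem (hlr 0 0 _ h₀ _ h₀') (hlr 1 0 _ h₁ _ h₀'))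
      (add_mem (hlr 0 1 _ h₀ _ h₁') (hlr 1 1 _ h₁ _ h₁'))

end Subalgebra

end

end LieConformal

/-! ### RE(4, 4) as a subalgebra -/

namespace LieConformal

open SuperPoly

noncomputable section

section RE

variable (F : Type*) [Field F]

lemma alpha_mem_rwGr (i : Fin 4 ⊕ Fin 4) : alpha F i ∈ rwGr F 4 4 (typeParity 4 4 i) := by
  rw [rwGr, Submodule.mem_pi]
  intro k _
  rw [alpha_apply]
  exact alphaCoeff_mem_homog F i k

/-- In the bracket formula every term has λ's in front of an F[∂]-multiple of some α_k, so closure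
can be read off. -/
lemma rwBr_alpha_mem [CharZero F] (i j : Fin 4 ⊕ Fin 4) : rwBr F 4 4 (alpha F i) (alpha F j) ∈
    LinearMap.range (LinearMap.lTensor (Poly F 4 4) ((RE F).subtype.restrictScalars F)) := by
  set N := LinearMap.range (LinearMap.lTensor (Poly F 4 4) ((RE F).subtype.restrictScalars F))
  have hα : ∀ k, alpha F k ∈ RE F := fun k => Submodule.subset_span ⟨k, rfl⟩
  have ht : ∀ P : Poly F 4 4, ∀ x ∈ RE F, P ⊗ₜ[F] x ∈ N := fun P x hx => ⟨P ⊗ₜ ⟨x, hx⟩, rfl⟩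
  have hs : ∀ P : Poly F 4 4, ∀ t ∈ N, P • t ∈ N := by
    rintro P _ ⟨t, rfl⟩
    exact ⟨P • t, lTensor_smul _ P t⟩
  have hact : ∀ t, actOn F (alpha F j) t ∈ N := by
    intro t
    induction t with
    | zero => rw [map_zero]; exact zero_mem _
    | tmul P Q => exact ht P _ ((RE F).smul_mem Q (hα j))
    | add x y hx hy => rw [map_add]; exact add_mem hx hy
  rw [rwBr_alpha]
  refine add_mem (add_mem (hs _ _ ?_) (hs _ _ ?_)) ?_
  · rw [pairC_eq_sum]
    exact Submodule.sum_mem _ fun n _ => ht _ _ (hα _)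
  · exact Submodule.sum_mem _ fun n _ => ht _ _ (hα _)
  · exact hact _

end RE

end

end LieConformal

open SuperPoly LieConformal in
theorem mainTheorem2 (F : Type*) [Field F] [CharZero F] :
    (∀ i j : Fin 4 ⊕ Fin 4,
      rwBr F 4 4 (alpha F i) (alpha F j) =
        (X i * X j * pairB (· * ·) X X - 2 * X i * cubic F j - 2 * X j * cubic F i : Poly F 4 4) •
            pairC (fun P x => P ⊗ₜ[F] x) X (alpha F)
          + (3 * X i * X j : Poly F 4 4) • pairB (fun P x => P ⊗ₜ[F] x) (cubic F) (alpha F)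
          + actOn F (alpha F j)
              ((X i : Poly F 4 4) • pairC (fun P Q => P ⊗ₜ[F] Q) (cubic F) X
                + (X i * pairB (· * ·) X X : Poly F 4 4) • pairC (fun P Q => P ⊗ₜ[F] Q) X X
                - (2 * cubic F i) • pairC (fun P Q => P ⊗ₜ[F] Q) X X)) ∧
    IsLieConformalSuperalgebra (rwGr F 4 4) (rwBr F 4 4) ∧
    IsLieConformalSubalgebra (rwGr F 4 4) (rwBr F 4 4) (RE F) :=
  ⟨rwBr_alpha F, isLieConformalSuperalgebra_rw F 4 4,
    (isLieConformalSuperalgebra_rw F 4 4).isSubalgebra_span (alpha_mem_rwGr F) (rwBr_alpha_mem F)⟩
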